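/- Notation. For real $a,b$ let $\omega^{(a,b)}(x)=(1-x)^a x^b$ on $(0,1)$, $(g,h)_{\omega}=\int_0^1\omega\, g\,h\,dx$, and let $L^2_{\omega}(0,1)$ be the space of measurable $g$ with $\|g\|_\omega^2=(g,g)_\omega<\infty$. Let $P_n^{(a,b)}(x)=2^{-n}\sum_{m=0}^n\binom{n+a}{m}\binom{n+b}{n-m}(x-1)^{n-m}(x+1)^m$ be the Jacobi polynomials and $G_n^{(a,b)}(t)=P_n^{(a,b)}(2t-1)$. For $0<\sigma<1$ let $${}_0I_x^{\sigma}w(x)=\frac1{\Gamma(\sigma)}\int_0^x w(s)(x-s)^{\sigma-1}ds,\qquad {}_xI_1^{\sigma}w(x)=\frac1{\Gamma(\sigma)}\int_x^1 w(s)(s-x)^{\sigma-1}ds .$$ Theorem. Let $1<\alpha<2$, $0\le r\le1$, and let $\beta\in[\alpha-1,1]$ be determined by $r=\dfrac{\sin(\pi\beta)}{\sin(\pi(\alpha-\beta))+\sin(\pi\beta)}$. Let $K$ be measurable on $(0,1)$ with $0<K_m\le K(x)\le K_M<\infty$, and let $f\in L^2_{\omega^{(\beta,\alpha-\beta)}}(0,1)$;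 if $r=1$, assume also $f\in L^1(0,1)$. Put $f_1(x)=\frac1{K(x)}\int_0^x f(y)\,dy$, $f_2(x)=\frac1{K(x)}$, $\omega=\omega^{(\beta-1,\alpha-\beta-1)}$. Then $f$ is integrable on $(0,x)$ for every $x\in(0,1)$, $f_1,f_2\in L^2_\omega(0,1)$, $(K^{-1},1)_\omega>0$, and with $$A=\frac{(f_1,1)_{\omega}}{(K^{-1},1)_{\omega}}$$ the problem $$L_r^\alpha u:=-\big(r\,{}_0I_x^{2-\alpha}+(1-r)\,{}_xI_1^{2-\alpha}\big)Du=f_1-A f_2\ \text{ on }(0,1),\qquad u(0)=u(1)=0,$$ has a solution $u\in L^2_{\omega^{(-(\alpha-\beta),-\beta)}}(0,1)$, for which $A$ is the value at $x=0$ of the flux $K\big(r\,{}_0I_x^{2-\alpha}+(1-r)\,{}_xI_1^{2-\alpha}\big)Du$ (which agrees almost everywhere with a function continuous on $[0,1)$). The solution is $$u=\omega^{(\alpha-\beta,\beta)}\sum_{j=0}^\infty c_j\,G_j^{(\alpha-\beta,\beta)},\qquad c_j=\frac{-f_{1,j+1}+A f_{2,j+1}}{\lambda_j},$$ with convergence in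 $L^2_{\omega^{(-(\alpha-\beta),-\beta)}}(0,1)$, where $f_{i,j}=(f_i,G_j^{(\beta-1,\alpha-\beta-1)})_\omega/\|G_j^{(\beta-1,\alpha-\beta-1)}\|_\omega^2$ and $\lambda_j=\dfrac{\sin(\pi\alpha)}{\sin(\pi(\alpha-\beta))+\sin(\pi\beta)}\,\dfrac{\Gamma(j+\alpha)}{j!}$. Here $u\in L^2_{\omega^{(-(\alpha-\beta),-\beta)}}(0,1)$ is called a solution of $L_r^\alpha u=g$, $u(0)=u(1)=0$, with $g\in L^2_\omega(0,1)$, if the equation holds in the sense of distributions, that is, $\int_0^1 u\,D\big(r\,{}_xI_1^{2-\alpha}+(1-r)\,{}_0I_x^{2-\alpha}\big)\varphi\,dx=\int_0^1 g\,\varphi\,dx$ for all $\varphi\in C_c^\infty(0,1)$, and there are absolutely continuous functions $v_n$ on $[0,1]$ with $v_n(0)=v_n(1)=0$, $v_n\in L^2_{\omega^{(-(\alpha-\beta),-\beta)}}(0,1)$ and $L_r^\alpha v_n\in L^2_\omega(0,1)$, such that $v_n\to u$ in $L^2_{\omega^{(-(\alpha-\beta),-\beta)}}(0,1)$ and $L_r^\alpha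 v_n\to g$ in $L^2_\omega(0,1)$. -/

import Mathlib

open MeasureTheory Set Filter Topology
open scoped ContDiff ENNReal

noncomputable section

namespace FracDiff

/-- The Jacobi weight `ω^{(a,b)}(x) = (1 - x)^a x^b` on `(0,1)`. -/
def jacobiWeight (a b x : ℝ) : ℝ := (1 - x) ^ a * x ^ b

/-- The measure `ω^{(a,b)}(x) dx` on `(0,1)`. The weighted space `L²_{ω^{(a,b)}}(0,1)` consists of the
functions `f` with `MemLp f 2 (jacobiMeasure a b)`, and its norm is `eLpNorm · 2 (jacobiMeasure a b)`. -/
def jacobiMeasure (a b : ℝ) : Measure ℝ :=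
  (volume.restrict (Ioo (0 : ℝ) 1)).withDensity (fun x => ENNReal.ofReal (jacobiWeight a b x))

/-- The weighted inner product `(f, g)_{ω^{(a,b)}} = ∫₀¹ ω^{(a,b)} f g dx`. -/
def wInner (a b : ℝ) (f g : ℝ → ℝ) : ℝ :=
  ∫ x in Ioo (0 : ℝ) 1, jacobiWeight a b x * f x * g x

/-- The Jacobi polynomial `P_n^{(a,b)}` on `[-1,1]`. -/
def jacobiP (n : ℕ) (a b x : ℝ) : ℝ :=
  ∑ m ∈ Finset.range (n + 1),
    (1 / 2 ^ n * Ring.choose ((n : ℝ) + a) m * Ring.choose ((n : ℝ) + b) (n - m)) *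
      (x - 1) ^ (n - m) * (x + 1) ^ m

/-- The Jacobi polynomial transplanted to `[0,1]`: `G_n^{(a,b)}(t) = P_n^{(a,b)}(2t - 1)`. -/
def jacobiG (n : ℕ) (a b t : ℝ) : ℝ := jacobiP n a b (2 * t - 1)

/-- The left fractional integral `₀I_x^σ w`. -/
def leftFracInt (σ : ℝ) (w : ℝ → ℝ) (x : ℝ) : ℝ :=
  1 / Real.Gamma σ * ∫ s in (0 : ℝ)..x, w s * (x - s) ^ (σ - 1)

/-- The right fractional integral `ₓI_1^σ w`. -/
def rightFracInt (σ : ℝ) (w : ℝ → ℝ) (x : ℝ) : ℝ :=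
  1 / Real.Gamma σ * ∫ s in x..(1 : ℝ), w s * (s - x) ^ (σ - 1)

/-- The two-sided fractional integral `r ₀I_x^{2-α} + (1-r) ₓI_1^{2-α}`. -/
def twoSidedFracInt (α r : ℝ) (w : ℝ → ℝ) (x : ℝ) : ℝ :=
  r * leftFracInt (2 - α) w x + (1 - r) * rightFracInt (2 - α) w x

/-- The operator `L_r^α v = -(r ₀I_x^{2-α} + (1-r) ₓI_1^{2-α}) D v` for functions `v` that have a
derivative almost everywhere. -/
def opL (α r : ℝ) (v : ℝ → ℝ) (x : ℝ) : ℝ := -twoSidedFracInt α r (deriv v) x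

/-- A classical element of the domain of `L_r^α` with homogeneous Dirichlet conditions: `v` is
absolutely continuous on `[0,1]`, `v(0) = v(1) = 0`, and `v`, `L_r^α v` belong to the weighted spaces
`L²_{ω^{(-(α-β),-β)}}` and `L²_{ω^{(β-1,α-β-1)}}`. -/
structure IsClassicalDirichlet (α r β : ℝ) (v : ℝ → ℝ) : Prop where
  absCont : AbsolutelyContinuousOnInterval v 0 1
  left_zero : v 0 = 0
  right_zero : v 1 = 0
  memLp : MemLp v 2 (jacobiMeasure (-(α - β)) (-β))
  memLp_opL : MemLp (opL α r v) 2 (jacobiMeasure (β - 1) (α - β - 1))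

/-- `L_r^α u = g` on `(0,1)` in the sense of distributions. Transposition gives
`⟨-T D u, φ⟩ = -⟨D u, T* φ⟩ = ⟨u, D (T* φ)⟩` for `u` vanishing at `0` and `1`, where
`T = r ₀I_x^{2-α} + (1-r) ₓI_1^{2-α}` and its transpose `T*` is obtained from `T` by exchanging
`r` and `1 - r`. -/
def WeakEquation (α r : ℝ) (u g : ℝ → ℝ) : Prop :=
  ∀ φ : ℝ → ℝ, ContDiff ℝ ∞ φ → HasCompactSupport φ → tsupport φ ⊆ Ioo (0 : ℝ) 1 →
    ∫ x in Ioo (0 : ℝ) 1, u x * deriv (twoSidedFracInt α (1 - r) φ) x =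
      ∫ x in Ioo (0 : ℝ) 1, g x * φ x

/-- `L_r^α u = g` on `(0,1)`, `u(0) = u(1) = 0`, for `u` in the weighted space
`L²_{ω^{(-(α-β),-β)}}` (such a `u` is in general not differentiable). The equation holds in the
sense of distributions, and, in the same way as for the space `H¹₀`, the boundary condition says
that `u` is a limit, in the graph norm of `L_r^α`, of absolutely continuous functions that vanish
at `0` and `1`. -/
structure SolvesDirichlet (α r β : ℝ) (u g : ℝ → ℝ) : Prop where
  memLp : MemLp u 2 (jacobiMeasure (-(α - β)) (-β))
  memLp_rhs : MemLp g 2 (jacobiMeasure (β - 1) (α - β - 1))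
  equation : WeakEquation α r u g
  boundary : ∃ v : ℕ → ℝ → ℝ, (∀ n, IsClassicalDirichlet α r β (v n)) ∧
    Tendsto (fun n => eLpNorm (fun x => v n x - u x) 2 (jacobiMeasure (-(α - β)) (-β)))
      atTop (𝓝 0) ∧
    Tendsto (fun n => eLpNorm (fun x => opL α r (v n) x - g x) 2
      (jacobiMeasure (β - 1) (α - β - 1))) atTop (𝓝 0)

/-- `f₁(x) = (1 / K(x)) ∫₀ˣ f(y) dy`. -/
def f₁ (K f : ℝ → ℝ) (x : ℝ) : ℝ := 1 / K x * ∫ y in (0 : ℝ)..x, f y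

/-- `f₂(x) = 1 / K(x)`. -/
def f₂ (K : ℝ → ℝ) (x : ℝ) : ℝ := 1 / K x

/-- `u` is a solution of `L_r^α u = f₁ - A f₂`, `u(0) = u(1) = 0`, where `A` is the value at `x = 0` of
the flux `q = K (r ₀I_x^{2-α} + (1-r) ₓI_1^{2-α}) D u`. The flux is an almost everywhere defined
function; it has a value at `0` through a representative that is continuous on `[0,1)`. -/
structure IsSolution (α r β : ℝ) (K f u : ℝ → ℝ) (A : ℝ) : Prop where
  solves : SolvesDirichlet α r β u (fun x => f₁ K f x - A * f₂ K x)
  flux : ∃ q : ℝ → ℝ, ContinuousOn q (Ico 0 1) ∧ q 0 = A ∧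
    SolvesDirichlet α r β u (fun x => -(q x / K x))

/-- `A = (f₁, 1)_ω / (K⁻¹, 1)_ω` with `ω = ω^{(β-1,α-β-1)}`. -/
def constA (α β : ℝ) (K f : ℝ → ℝ) : ℝ :=
  wInner (β - 1) (α - β - 1) (f₁ K f) (fun _ => 1) /
    wInner (β - 1) (α - β - 1) (fun x => (K x)⁻¹) (fun _ => 1)

/-- The Jacobi coefficient `(h, G_j)_ω / ‖G_j‖²_ω` with `G_j = G_j^{(β-1,α-β-1)}` and
`ω = ω^{(β-1,α-β-1)}`. -/
def jacobiCoeff (α β : ℝ) (h : ℝ → ℝ) (j : ℕ) : ℝ :=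
  wInner (β - 1) (α - β - 1) h (jacobiG j (β - 1) (α - β - 1)) /
    wInner (β - 1) (α - β - 1) (jacobiG j (β - 1) (α - β - 1)) (jacobiG j (β - 1) (α - β - 1))

/-- `λ_n = sin(πα) / (sin(π(α-β)) + sin(πβ)) · Γ(n+α) / n!`. -/
def eigenvalue (α β : ℝ) (n : ℕ) : ℝ :=
  Real.sin (Real.pi * α) / (Real.sin (Real.pi * (α - β)) + Real.sin (Real.pi * β)) *
    (Real.Gamma (n + α) / n.factorial)

/-- The coefficients `c_j = (-f_{1,j+1} + A f_{2,j+1}) / λ_j` of the solution. -/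
def solCoeff (α β : ℝ) (K f : ℝ → ℝ) (j : ℕ) : ℝ :=
  (-jacobiCoeff α β (f₁ K f) (j + 1) + constA α β K f * jacobiCoeff α β (f₂ K) (j + 1)) /
    eigenvalue α β j

/-- The sum of the first `N` terms of `ω^{(α-β,β)} ∑_j c_j G_j^{(α-β,β)}`. -/
def partialSol (α β : ℝ) (K f : ℝ → ℝ) (N : ℕ) (x : ℝ) : ℝ :=
  jacobiWeight (α - β) β x *
    ∑ j ∈ Finset.range N, solCoeff α β K f j * jacobiG j (α - β) β x

end FracDiff

end

noncomputable section

namespace FracDiff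

open Polynomial

/-! ### Jacobi polynomials on the unit interval as formal polynomials: derivative, Rodrigues step,
leading coefficient. -/

section JacobiAlgebra

/-! Write a = α - β, b = β and T for the two-sided fractional integral. The operator is diagonal
between two Jacobi families: L maps ω^{(a,b)} G_j^{(a,b)} to -λ_j G_{j+1}^{(b-1,a-1)}. The
derivative contributes D(ω^{(a,b)} G_j^{(a,b)}) = -(j+1) ω^{(a-1,b-1)} G_{j+1}^{(a-1,b-1)}
(`rodrigues_step`), and T sends ω^{(a-1,b-1)} G_n^{(a-1,b-1)} to a multiple of G_n^{(b-1,a-1)}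
(`Admissible.abelOp_jacobiPoly`).

The second fact rests on three observations. The relation between r and β makes T ω^{(a-1,b-1)}
constant: the derivatives of the two one-sided integrals are opposite multiples of x^{-a}(1-x)^{-b}
(`sin_mul_eulerInt_add`). Since z · kern(z) is an antiderivative of a multiple of the kernel, T
takes ω^{(a-1,b-1)} times a polynomial to a polynomial of no larger degree, with known factor on the
leading coefficient (`Admissible.abelOp_polynomial`). Transposing T exchanges a and b, so the image
of the n-th Jacobi polynomial is ω^{(b-1,a-1)}-orthogonal to all lower degrees, which identifies it.

The range misses G_0 = 1, hence a right-hand side g must be ω-orthogonal to constants; for g = f₁ -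
A f₂ this is precisely the formula for A. Both families are orthogonal in their weighted spaces, the
|λ_j| are bounded below by |λ_0| > 0, and ω^{(a,b)} G_j^{(a,b)} has norm at most that of
G_{j+1}^{(b-1,a-1)}. Convergence of the Jacobi series of g therefore forces convergence of the
series for u (`Admissible.exists_solution`). Its partial sums are absolutely continuous, vanish at
both ends and converge in the graph norm; the weak equation passes to the limit. The flux is A - ∫₀ˣ
f, because -(A - ∫₀ˣ f)/K = f₁ - A f₂. -/

theorem succ_mul_choose_succ (x : ℝ) (k : ℕ) :
    ((k : ℝ) + 1) * Ring.choose x (k + 1) = (x - k) * Ring.choose x k := by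
  have h := Ring.choose_smul_choose x (n := k + 1) (k := k) (Nat.le_succ k)
  rw [Nat.choose_succ_self_right, Nat.add_sub_cancel_left, Ring.choose_one_right] at h
  rw [nsmul_eq_mul] at h
  push_cast at h
  rw [h, mul_comm]

/-- The Jacobi polynomial on `[0,1]` as an element of `ℝ[X]`. -/
def jacobiPoly (n : ℕ) (a b : ℝ) : ℝ[X] :=
  ∑ m ∈ Finset.range (n + 1),
    C (Ring.choose ((n : ℝ) + a) m * Ring.choose ((n : ℝ) + b) (n - m)) *
      ((X - 1) ^ (n - m) * X ^ m)

theorem eval_jacobiPoly (n : ℕ) (a b t : ℝ) : (jacobiPoly n a b).eval t = jacobiG n a b t := by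
  unfold jacobiPoly jacobiG jacobiP
  rw [eval_finsetSum]
  refine Finset.sum_congr rfl fun m hm => ?_
  have hm' : n - m + m = n := Nat.sub_add_cancel (Nat.lt_succ_iff.1 (Finset.mem_range.1 hm))
  simp only [eval_mul, eval_C, eval_pow, eval_sub, eval_X, eval_one]
  have e1 : 2 * t - 1 - 1 = 2 * (t - 1) := by ring
  have e2 : 2 * t - 1 + 1 = 2 * t := by ring
  rw [e1, e2, mul_pow, mul_pow]
  have h2 : (2 : ℝ) ^ n = 2 ^ (n - m) * 2 ^ m := by rw [← pow_add, hm']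
  rw [h2]
  field_simp

theorem natDegree_jacobiPoly_le (n : ℕ) (a b : ℝ) : (jacobiPoly n a b).natDegree ≤ n := by
  refine natDegree_sum_le_of_forall_le _ _ fun m hm => ?_
  have hm' : n - m + m = n := Nat.sub_add_cancel (Nat.lt_succ_iff.1 (Finset.mem_range.1 hm))
  refine (natDegree_C_mul_le _ _).trans ?_
  have : ((X - 1 : ℝ[X]) ^ (n - m) * X ^ m).natDegree = n := by
    rw [← C_1, ((monic_X_sub_C (1 : ℝ)).pow _).natDegree_mul (monic_X_pow m), natDegree_pow,
      natDegree_X_sub_C, natDegree_X_pow, mul_one, hm']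
  exact this.le

theorem coeff_jacobiPoly (n : ℕ) (a b : ℝ) : (jacobiPoly n a b).coeff n =
    ∑ m ∈ Finset.range (n + 1), Ring.choose ((n : ℝ) + a) m * Ring.choose ((n : ℝ) + b) (n - m) := by
  unfold jacobiPoly
  rw [finsetSum_coeff]
  refine Finset.sum_congr rfl fun m hm => ?_
  have hm' : n - m + m = n := Nat.sub_add_cancel (Nat.lt_succ_iff.1 (Finset.mem_range.1 hm))
  have hmon : ((X - 1 : ℝ[X]) ^ (n - m) * X ^ m).Monic := by
    rw [← C_1]; exact ((monic_X_sub_C (1 : ℝ)).pow _).mul (monic_X_pow m)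
  have : ((X - 1 : ℝ[X]) ^ (n - m) * X ^ m).natDegree = n := by
    rw [← C_1, ((monic_X_sub_C (1 : ℝ)).pow _).natDegree_mul (monic_X_pow m), natDegree_pow,
      natDegree_X_sub_C, natDegree_X_pow, mul_one, hm']
  have h1 := hmon.coeff_natDegree
  rw [this] at h1
  rw [coeff_C_mul, h1, mul_one]

/-- Reversing the sum exchanges the two binomial factors. This later matches the leading
coefficients of G_n^{(a-1,b-1)} and G_n^{(b-1,a-1)}. -/
theorem coeff_jacobiPoly_swap (n : ℕ) (a b : ℝ) :
    (jacobiPoly n a b).coeff n = (jacobiPoly n b a).coeff n := by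
  rw [coeff_jacobiPoly, coeff_jacobiPoly, ← Finset.sum_range_reflect]
  refine Finset.sum_congr rfl fun m hm => ?_
  have hm' : m ≤ n := Nat.lt_succ_iff.1 (Finset.mem_range.1 hm)
  have e1 : n + 1 - 1 - m = n - m := by omega
  have e2 : n - (n - m) = m := by omega
  rw [e1, e2, mul_comm]

theorem jacobiG_one_sub (n : ℕ) (a b t : ℝ) :
    jacobiG n a b (1 - t) = (-1) ^ n * jacobiG n b a t := by
  rw [← eval_jacobiPoly, ← eval_jacobiPoly]
  unfold jacobiPoly
  rw [eval_finsetSum, eval_finsetSum, ← Finset.sum_range_reflect, Finset.mul_sum]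
  refine Finset.sum_congr rfl fun m hm => ?_
  have hm' : m ≤ n := Nat.lt_succ_iff.1 (Finset.mem_range.1 hm)
  have e1 : n + 1 - 1 - m = n - m := by omega
  have e2 : n - (n - m) = m := by omega
  rw [e1, e2]
  simp only [eval_mul, eval_C, eval_pow, eval_sub, eval_X, eval_one]
  have e3 : (1 - t) - 1 = (-1) * t := by ring
  have e4 : 1 - t = (-1) * (t - 1) := by ring
  have h2 : (-1 : ℝ) ^ n = (-1) ^ (n - m) * (-1) ^ m := by rw [← pow_add, Nat.sub_add_cancel hm']
  rw [e3, e4, mul_pow, mul_pow, h2]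
  ring

theorem X_mul_derivative_X_pow (m : ℕ) :
    (X : ℝ[X]) * derivative (X ^ m) = C (m : ℝ) * X ^ m := by
  cases m with
  | zero => simp
  | succ k => rw [derivative_X_pow]; simp; ring

theorem X_sub_one_mul_derivative_pow (m : ℕ) :
    (X - 1 : ℝ[X]) * derivative ((X - 1) ^ m) = C (m : ℝ) * (X - 1) ^ m := by
  cases m with
  | zero => simp
  | succ k => rw [derivative_pow]; simp; ring

theorem derivative_jacobiPoly (n : ℕ) (a b : ℝ) :
    derivative (jacobiPoly (n + 1) a b) =
      C ((n : ℝ) + a + b + 2) * jacobiPoly n (a + 1) (b + 1) := by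
  have key : ∀ m ∈ Finset.range (n + 1 + 1), derivative
      (C (Ring.choose (((n + 1 : ℕ) : ℝ) + a) m * Ring.choose (((n + 1 : ℕ) : ℝ) + b) (n + 1 - m)) *
      ((X - 1) ^ (n + 1 - m) * X ^ m) : ℝ[X]) =
      C (Ring.choose (((n + 1 : ℕ) : ℝ) + a) m * Ring.choose (((n + 1 : ℕ) : ℝ) + b) (n + 1 - m)) *
        (C ((n + 1 - m : ℕ) : ℝ) * ((X - 1) ^ (n + 1 - m - 1) * X ^ m)) +
      C (Ring.choose (((n + 1 : ℕ) : ℝ) + a) m * Ring.choose (((n + 1 : ℕ) : ℝ) + b) (n + 1 - m)) *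
        (C (m : ℝ) * ((X - 1) ^ (n + 1 - m) * X ^ (m - 1))) := by
    intro m hm
    rw [derivative_C_mul, derivative_mul, derivative_pow, derivative_X_pow]
    simp only [derivative_sub, derivative_X, derivative_one, sub_zero, mul_one]
    ring
  unfold jacobiPoly
  -- The term m = n + 1 of the first sum and the term m = 0 of the second carry a zero factor;
  -- dropping them leaves two sums over m ≤ n in the same products.
  rw [derivative_sum, Finset.sum_congr rfl key, Finset.sum_add_distrib,
    Finset.sum_range_succ, Finset.sum_range_succ' _ (n + 1), Finset.mul_sum]
  simp only [Nat.sub_self, Nat.cast_zero, C_0, zero_mul, mul_zero, add_zero]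
  rw [← Finset.sum_add_distrib]
  refine Finset.sum_congr rfl fun m hm => ?_
  have hm' : m ≤ n := Nat.lt_succ_iff.1 (Finset.mem_range.1 hm)
  obtain ⟨k, rfl⟩ := Nat.exists_eq_add_of_le hm'
  have e1 : m + k + 1 - m = k + 1 := by omega
  have e2 : m + k + 1 - (m + 1) = k := by omega
  have e3 : m + k - m = k := by omega
  rw [e1, e2, e3, Nat.add_sub_cancel, Nat.add_sub_cancel]
  have h1 := succ_mul_choose_succ ((m + k + 1 : ℕ) + a) m
  have h2 := succ_mul_choose_succ ((m + k + 1 : ℕ) + b) k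
  have e4 : ((m + k : ℕ) : ℝ) + (a + 1) = (m + k + 1 : ℕ) + a := by push_cast; ring
  have e5 : ((m + k : ℕ) : ℝ) + (b + 1) = (m + k + 1 : ℕ) + b := by push_cast; ring
  rw [e4, e5]
  simp only [← mul_assoc, ← C_mul]
  rw [← add_mul, ← add_mul, ← C_add]
  congr 3
  push_cast at h1 h2 ⊢
  linear_combination Ring.choose ((m : ℝ) + k + 1 + a) m * h2 + Ring.choose ((m : ℝ) + k + 1 + b) k * h1

/-- The polynomial form of `D (ω^{(a+1,b+1)} G_n^{(a+1,b+1)}) = -(n+1) ω^{(a,b)} G_{n+1}^{(a,b)}`. -/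
theorem rodrigues_step (n : ℕ) (a b : ℝ) :
    (C (b + 1) * (1 - X) - C (a + 1) * X) * jacobiPoly n (a + 1) (b + 1) +
      X * (1 - X) * derivative (jacobiPoly n (a + 1) (b + 1)) =
    - C ((n : ℝ) + 1) * jacobiPoly (n + 1) a b := by
  have key : ∀ m ∈ Finset.range (n + 1),
      (C (b + 1) * (1 - X) - C (a + 1) * X) *
        (C (Ring.choose ((n : ℝ) + (a + 1)) m * Ring.choose ((n : ℝ) + (b + 1)) (n - m)) *
          ((X - 1) ^ (n - m) * X ^ m)) + X * (1 - X) * derivative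
        (C (Ring.choose ((n : ℝ) + (a + 1)) m * Ring.choose ((n : ℝ) + (b + 1)) (n - m)) *
          ((X - 1) ^ (n - m) * X ^ m)) =
      - C ((m : ℝ) + 1) * (C (Ring.choose (((n + 1 : ℕ) : ℝ) + a) (m + 1) *
          Ring.choose (((n + 1 : ℕ) : ℝ) + b) (n + 1 - (m + 1))) *
          ((X - 1) ^ (n + 1 - (m + 1)) * X ^ (m + 1))) +
      - C ((n : ℝ) + 1 - m) * (C (Ring.choose (((n + 1 : ℕ) : ℝ) + a) m *
          Ring.choose (((n + 1 : ℕ) : ℝ) + b) (n + 1 - m)) *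
          ((X - 1) ^ (n + 1 - m) * X ^ m)) := by
    intro m hm
    have hm' : m ≤ n := Nat.lt_succ_iff.1 (Finset.mem_range.1 hm)
    obtain ⟨k, rfl⟩ := Nat.exists_eq_add_of_le hm'
    have e1 : m + k + 1 - m = k + 1 := by omega
    have e2 : m + k + 1 - (m + 1) = k := by omega
    have e3 : m + k - m = k := by omega
    rw [e1, e2, e3]
    have h1 := succ_mul_choose_succ ((m + k + 1 : ℕ) + a) m
    have h2 := succ_mul_choose_succ ((m + k + 1 : ℕ) + b) k
    have e4 : ((m + k : ℕ) : ℝ) + (a + 1) = (m + k + 1 : ℕ) + a := by push_cast; ring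
    have e5 : ((m + k : ℕ) : ℝ) + (b + 1) = (m + k + 1 : ℕ) + b := by push_cast; ring
    rw [e4, e5, derivative_C_mul, derivative_mul]
    set P := Ring.choose (((m + k + 1 : ℕ) : ℝ) + a) m
    set P' := Ring.choose (((m + k + 1 : ℕ) : ℝ) + a) (m + 1)
    set Q := Ring.choose (((m + k + 1 : ℕ) : ℝ) + b) k
    set Q' := Ring.choose (((m + k + 1 : ℕ) : ℝ) + b) (k + 1)
    have d1 := X_mul_derivative_X_pow m
    have d2 := X_sub_one_mul_derivative_pow k
    have g1 := congrArg (C : ℝ → ℝ[X]) h1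
    have g2 := congrArg (C : ℝ → ℝ[X]) h2
    push_cast at g1 g2 d1 d2 ⊢
    simp only [C_mul, C_add, C_sub, C_1, map_natCast] at g1 g2 d1 d2 ⊢
    rw [pow_succ (X - 1 : ℝ[X]) k, pow_succ (X : ℝ[X]) m]
    linear_combination (- C P * C Q * X * X ^ m) * d2 - (C P * C Q * (X - 1) ^ k * (X - 1)) * d1
      + C Q * (X - 1) ^ k * X ^ m * X * g1 + C P * (X - 1) ^ k * (X - 1) * X ^ m * g2
  unfold jacobiPoly
  rw [derivative_sum, Finset.mul_sum, Finset.mul_sum, ← Finset.sum_add_distrib,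
    Finset.sum_congr rfl key, Finset.sum_add_distrib]
  -- By `key`, the summand m in degree n feeds the summands m + 1 and m in degree n + 1. After
  -- reindexing, summand m receives -m and -(n + 1 - m), in total -(n + 1); the terms added at the
  -- ends have coefficient zero.
  have s1 : ∀ c : ℕ → ℝ[X], ∑ m ∈ Finset.range (n + 1), - C ((m : ℝ) + 1) * c (m + 1) =
      ∑ m ∈ Finset.range (n + 1 + 1), - C (m : ℝ) * c m := by
    intro c
    rw [Finset.sum_range_succ' _ (n + 1)]
    simp
  have s2 : ∀ c : ℕ → ℝ[X], ∑ m ∈ Finset.range (n + 1), - C ((n : ℝ) + 1 - m) * c m =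
      ∑ m ∈ Finset.range (n + 1 + 1), - C ((n : ℝ) + 1 - m) * c m := by
    intro c
    rw [Finset.sum_range_succ _ (n + 1)]
    simp
  have t1 := s1 fun m => C (Ring.choose (((n + 1 : ℕ) : ℝ) + a) m *
          Ring.choose (((n + 1 : ℕ) : ℝ) + b) (n + 1 - m)) * ((X - 1) ^ (n + 1 - m) * X ^ m)
  have t2 := s2 fun m => C (Ring.choose (((n + 1 : ℕ) : ℝ) + a) m *
          Ring.choose (((n + 1 : ℕ) : ℝ) + b) (n + 1 - m)) * ((X - 1) ^ (n + 1 - m) * X ^ m)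
  rw [t1, t2, ← Finset.sum_add_distrib, Finset.mul_sum]
  refine Finset.sum_congr rfl fun m _ => ?_
  rw [← add_mul, ← C_neg, ← C_neg, ← C_neg, ← C_add]
  congr 2
  ring

/-- Differentiation lowers the degree and raises a + b by 2, so the factor n + a + b + 2 stays
positive along the induction. -/
theorem coeff_jacobiPoly_pos (n : ℕ) : ∀ a b : ℝ, -2 < a + b → 0 < (jacobiPoly n a b).coeff n := by
  induction n with
  | zero => intro a b _; rw [coeff_jacobiPoly]; simp
  | succ n ih =>
    intro a b hab
    have h := congrArg (fun p => coeff p n) (derivative_jacobiPoly n a b)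
    simp only [coeff_derivative, coeff_C_mul] at h
    have h1 := ih (a + 1) (b + 1) (by linarith)
    have h2 : 0 < ((n : ℝ) + a + b + 2) * (jacobiPoly n (a + 1) (b + 1)).coeff n :=
      mul_pos (by have := (Nat.cast_nonneg n : (0 : ℝ) ≤ n); linarith) h1
    rw [← h] at h2
    exact pos_of_mul_pos_left h2 (by positivity)

end JacobiAlgebra

/-! ### Jacobi weights, their moments, and orthogonality. -/

section Weight

theorem measurable_jacobiWeight (a b : ℝ) : Measurable (jacobiWeight a b) := by
  unfold jacobiWeight
  fun_prop

theorem jacobiWeight_pos (a b : ℝ) {x : ℝ} (hx : x ∈ Ioo (0 : ℝ) 1) : 0 < jacobiWeight a b x :=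
  mul_pos (Real.rpow_pos_of_pos (sub_pos.2 hx.2) _) (Real.rpow_pos_of_pos hx.1 _)

theorem one_le_jacobiWeight {a b : ℝ} (ha : a ≤ 0) (hb : b ≤ 0) {x : ℝ} (hx : x ∈ Ioo (0 : ℝ) 1) :
    1 ≤ jacobiWeight a b x :=
  one_le_mul_of_one_le_of_one_le
    (Real.one_le_rpow_of_pos_of_le_one_of_nonpos (sub_pos.2 hx.2) (by linarith [hx.1]) ha)
    (Real.one_le_rpow_of_pos_of_le_one_of_nonpos hx.1 hx.2.le hb)

theorem jacobiWeight_mul (a b c d : ℝ) {x : ℝ} (hx : x ∈ Ioo (0 : ℝ) 1) :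
    jacobiWeight a b x * jacobiWeight c d x = jacobiWeight (a + c) (b + d) x := by
  unfold jacobiWeight
  rw [Real.rpow_add (sub_pos.2 hx.2), Real.rpow_add hx.1]
  ring

theorem jacobiWeight_add_one (a b : ℝ) {x : ℝ} (hx : x ∈ Ioo (0 : ℝ) 1) :
    jacobiWeight (a + 1) (b + 1) x = jacobiWeight a b x * (x * (1 - x)) := by
  rw [← jacobiWeight_mul a b 1 1 hx]
  simp only [jacobiWeight, Real.rpow_one]
  ring

theorem jacobiWeight_one_sub (a b x : ℝ) : jacobiWeight a b (1 - x) = jacobiWeight b a x := by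
  simp only [jacobiWeight, sub_sub_cancel]
  ring

theorem ofReal_betaIntegrand {p q x : ℝ} (hx : x ∈ Ioo (0 : ℝ) 1) :
    (x : ℂ) ^ ((p : ℂ) - 1) * (1 - (x : ℂ)) ^ ((q : ℂ) - 1) =
      ((jacobiWeight (q - 1) (p - 1) x : ℝ) : ℂ) := by
  unfold jacobiWeight
  rw [Complex.ofReal_mul, Complex.ofReal_cpow hx.1.le, Complex.ofReal_cpow (sub_pos.2 hx.2).le]
  push_cast
  ring

theorem integrableOn_jacobiWeight {a b : ℝ} (ha : -1 < a) (hb : -1 < b) :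
    IntegrableOn (jacobiWeight a b) (Ioo (0 : ℝ) 1) := by
  have h := Complex.betaIntegral_convergent (u := ((b + 1 : ℝ) : ℂ)) (v := ((a + 1 : ℝ) : ℂ))
    (by rw [Complex.ofReal_re]; linarith) (by rw [Complex.ofReal_re]; linarith)
  rw [intervalIntegrable_iff_integrableOn_Ioo_of_le zero_le_one] at h
  refine (IntegrableOn.congr_fun h.re (fun x hx => ?_) measurableSet_Ioo)
  simp only [ofReal_betaIntegrand hx, add_sub_cancel_right, RCLike.re_to_complex, Complex.ofReal_re]

theorem integral_jacobiWeight {p q : ℝ} (hp : 0 < p) (hq : 0 < q) :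
    ∫ x in Ioo (0 : ℝ) 1, jacobiWeight (q - 1) (p - 1) x = ProbabilityTheory.beta p q := by
  rw [ProbabilityTheory.beta_eq_betaIntegralReal p q hp hq, Complex.betaIntegral,
    intervalIntegral.integral_of_le zero_le_one, integral_Ioc_eq_integral_Ioo,
    setIntegral_congr_fun measurableSet_Ioo (fun x hx => ofReal_betaIntegrand (p := p) (q := q) hx),
    integral_complex_ofReal, Complex.ofReal_re]

theorem integrableOn_mul_of_continuousOn_Icc {w h : ℝ → ℝ} (hw : IntegrableOn w (Ioo (0 : ℝ) 1))
    (hh : ContinuousOn h (Icc 0 1)) : IntegrableOn (fun x => w x * h x) (Ioo (0 : ℝ) 1) := by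
  obtain ⟨c, hc⟩ := isCompact_Icc.exists_bound_of_continuousOn hh
  refine Integrable.mul_bdd (c := c) hw
    ((hh.mono Ioo_subset_Icc_self).aestronglyMeasurable measurableSet_Ioo) ?_
  filter_upwards [ae_restrict_mem measurableSet_Ioo] with x hx
  exact hc x (Ioo_subset_Icc_self hx)

theorem integrableOn_jacobiWeight_mul_eval {a b : ℝ} (ha : -1 < a) (hb : -1 < b) (p : ℝ[X]) :
    IntegrableOn (fun x => jacobiWeight a b x * p.eval x) (Ioo (0 : ℝ) 1) :=
  integrableOn_mul_of_continuousOn_Icc (integrableOn_jacobiWeight ha hb) p.continuous.continuousOn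

/-- The integral of a polynomial against a Jacobi weight. -/
def jacobiMoment (a b : ℝ) (p : ℝ[X]) : ℝ := ∫ x in Ioo (0 : ℝ) 1, jacobiWeight a b x * p.eval x

theorem jacobiMoment_add {a b : ℝ} (ha : -1 < a) (hb : -1 < b) (p q : ℝ[X]) :
    jacobiMoment a b (p + q) = jacobiMoment a b p + jacobiMoment a b q := by
  unfold jacobiMoment
  rw [← integral_add (integrableOn_jacobiWeight_mul_eval ha hb p)
    (integrableOn_jacobiWeight_mul_eval ha hb q)]
  simp only [eval_add, mul_add]

theorem jacobiMoment_C_mul (a b c : ℝ) (p : ℝ[X]) :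
    jacobiMoment a b (C c * p) = c * jacobiMoment a b p := by
  unfold jacobiMoment
  rw [← integral_const_mul]
  congr 1; ext x
  rw [eval_mul, eval_C]; ring

theorem hasDerivAt_jacobiWeight_mul_eval (a b : ℝ) (q : ℝ[X]) {x : ℝ} (hx : x ∈ Ioo (0 : ℝ) 1) :
    HasDerivAt (fun x => jacobiWeight (a + 1) (b + 1) x * q.eval x)
      (jacobiWeight a b x * ((C (b + 1) * (1 - X) - C (a + 1) * X) * q +
        X * (1 - X) * derivative q).eval x) x := by
  have h1 : HasDerivAt (fun x : ℝ => (1 - x) ^ (a + 1)) (-(a + 1) * (1 - x) ^ a) x := by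
    have := ((hasDerivAt_id x).const_sub 1).rpow_const (p := a + 1) (Or.inl (sub_pos.2 hx.2).ne')
    simpa [mul_comm] using this
  have h2 : HasDerivAt (fun x : ℝ => x ^ (b + 1)) ((b + 1) * x ^ b) x := by
    have := (hasDerivAt_id x).rpow_const (p := b + 1) (Or.inl hx.1.ne')
    simpa [mul_comm] using this
  refine ((h1.mul h2).mul (q.hasDerivAt x)).congr_deriv ?_
  have hx0 := hx.1
  have hx1 : 0 < 1 - x := sub_pos.2 hx.2
  simp only [jacobiWeight, Pi.mul_apply, eval_add, eval_mul, eval_sub, eval_C, eval_X, eval_one]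
  rw [Real.rpow_add_one hx0.ne', Real.rpow_add_one hx1.ne']
  ring

theorem continuous_jacobiWeight {a b : ℝ} (ha : 0 ≤ a) (hb : 0 ≤ b) :
    Continuous (jacobiWeight a b) := by
  unfold jacobiWeight
  exact ((continuous_const.sub continuous_id).rpow_const fun _ => Or.inr ha).mul
    (continuous_id.rpow_const fun _ => Or.inr hb)

/-- The integrand is the derivative of ω^{(a+1,b+1)} q, which vanishes at both ends because the
exponents are positive. -/
theorem jacobiMoment_derivative {a b : ℝ} (ha : -1 < a) (hb : -1 < b) (q : ℝ[X]) :
    jacobiMoment a b ((C (b + 1) * (1 - X) - C (a + 1) * X) * q + X * (1 - X) * derivative q) = 0 := by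
  have hi := integrableOn_jacobiWeight_mul_eval ha hb
    ((C (b + 1) * (1 - X) - C (a + 1) * X) * q + X * (1 - X) * derivative q)
  have h := intervalIntegral.integral_eq_sub_of_hasDerivAt_of_le (zero_le_one (α := ℝ))
    (((continuous_jacobiWeight (a := a + 1) (b := b + 1) (by linarith) (by linarith)).mul
      q.continuous).continuousOn) (fun x hx => hasDerivAt_jacobiWeight_mul_eval a b q hx)
    ((intervalIntegrable_iff_integrableOn_Ioo_of_le zero_le_one).2 hi)
  rw [intervalIntegral.integral_of_le zero_le_one, integral_Ioc_eq_integral_Ioo] at h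
  rw [jacobiMoment, h]
  simp [jacobiWeight, Real.zero_rpow (show a + 1 ≠ 0 by linarith),
    Real.zero_rpow (show b + 1 ≠ 0 by linarith)]

/-- Integration by parts: the Rodrigues step writes ω^{(a,b)} G_{n+1} as a derivative, and the
factor x(1-x) is absorbed into the weight. -/
theorem jacobiMoment_mul_jacobiPoly_succ {a b : ℝ} (ha : -1 < a) (hb : -1 < b) (n : ℕ) (p : ℝ[X]) :
    ((n : ℝ) + 1) * jacobiMoment a b (p * jacobiPoly (n + 1) a b) =
      jacobiMoment (a + 1) (b + 1) (derivative p * jacobiPoly n (a + 1) (b + 1)) := by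
  have h := jacobiMoment_derivative ha hb (p * jacobiPoly n (a + 1) (b + 1))
  have e : (C (b + 1) * (1 - X) - C (a + 1) * X) * (p * jacobiPoly n (a + 1) (b + 1)) +
      X * (1 - X) * derivative (p * jacobiPoly n (a + 1) (b + 1)) =
      X * (1 - X) * (derivative p * jacobiPoly n (a + 1) (b + 1)) +
        C (-((n : ℝ) + 1)) * (p * jacobiPoly (n + 1) a b) := by
    have := rodrigues_step n a b
    rw [derivative_mul, C_neg]
    linear_combination p * this
  rw [e, jacobiMoment_add ha hb, jacobiMoment_C_mul] at h
  have h2 : jacobiMoment (a + 1) (b + 1) (derivative p * jacobiPoly n (a + 1) (b + 1)) =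
      jacobiMoment a b (X * (1 - X) * (derivative p * jacobiPoly n (a + 1) (b + 1))) := by
    unfold jacobiMoment
    refine setIntegral_congr_fun measurableSet_Ioo fun x hx => ?_
    simp only [jacobiWeight_add_one a b hx, eval_mul, eval_sub, eval_X, eval_one]
    ring
  rw [h2]
  linarith

/-- Each integration by parts differentiates p once, so n of them annihilate it. The exponents stay
universally quantified since each step raises them by one. -/
theorem jacobiMoment_mul_jacobiPoly_eq_zero (n : ℕ) : ∀ {a b : ℝ}, -1 < a → -1 < b →
    ∀ p : ℝ[X], p.degree < n → jacobiMoment a b (p * jacobiPoly n a b) = 0 := by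
  induction n with
  | zero =>
    intro a b ha hb p hp
    have : p = 0 := by
      rw [degree_lt_iff_coeff_zero] at hp
      ext m; simpa using hp m (Nat.zero_le m)
    simp [this, jacobiMoment]
  | succ n ih =>
    intro a b ha hb p hp
    have h := jacobiMoment_mul_jacobiPoly_succ ha hb n p
    rw [ih (by linarith) (by linarith)] at h
    · exact (mul_eq_zero.1 h).resolve_left (by positivity)
    · rw [degree_lt_iff_coeff_zero] at hp ⊢
      intro m hm
      rw [coeff_derivative, hp (m + 1) (by omega), zero_mul]

theorem jacobiMoment_orthogonal {a b : ℝ} (ha : -1 < a) (hb : -1 < b) {m n : ℕ} (hmn : m ≠ n) :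
    jacobiMoment a b (jacobiPoly m a b * jacobiPoly n a b) = 0 := by
  rcases lt_or_gt_of_ne hmn with h | h
  · refine jacobiMoment_mul_jacobiPoly_eq_zero n ha hb _ ?_
    exact (degree_le_of_natDegree_le (natDegree_jacobiPoly_le m a b)).trans_lt (by exact_mod_cast h)
  · rw [mul_comm]
    refine jacobiMoment_mul_jacobiPoly_eq_zero m ha hb _ ?_
    exact (degree_le_of_natDegree_le (natDegree_jacobiPoly_le n a b)).trans_lt (by exact_mod_cast h)

theorem jacobiMoment_sq_succ {a b : ℝ} (ha : -1 < a) (hb : -1 < b) (n : ℕ) :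
    ((n : ℝ) + 1) * jacobiMoment a b (jacobiPoly (n + 1) a b * jacobiPoly (n + 1) a b) =
      ((n : ℝ) + a + b + 2) * jacobiMoment (a + 1) (b + 1)
        (jacobiPoly n (a + 1) (b + 1) * jacobiPoly n (a + 1) (b + 1)) := by
  rw [jacobiMoment_mul_jacobiPoly_succ ha hb, derivative_jacobiPoly, mul_assoc, jacobiMoment_C_mul]

theorem setIntegral_Ioo_one_sub (h : ℝ → ℝ) :
    ∫ x in Ioo (0 : ℝ) 1, h (1 - x) = ∫ x in Ioo (0 : ℝ) 1, h x := by
  rw [← integral_Ioc_eq_integral_Ioo, ← integral_Ioc_eq_integral_Ioo,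
    ← intervalIntegral.integral_of_le zero_le_one, ← intervalIntegral.integral_of_le zero_le_one,
    intervalIntegral.integral_comp_sub_left h 1]
  simp

theorem jacobiMoment_sq_swap (n : ℕ) (a b : ℝ) :
    jacobiMoment a b (jacobiPoly n a b * jacobiPoly n a b) =
      jacobiMoment b a (jacobiPoly n b a * jacobiPoly n b a) := by
  unfold jacobiMoment
  rw [← setIntegral_Ioo_one_sub]
  congr 1; ext x
  rw [jacobiWeight_one_sub, eval_mul, eval_mul, eval_jacobiPoly, eval_jacobiPoly, jacobiG_one_sub]
  have : ((-1 : ℝ) ^ n) * (-1) ^ n = 1 := by rw [← mul_pow]; simp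
  linear_combination (jacobiWeight b a x * (jacobiG n b a x) ^ 2) * this

theorem eq_zero_of_ae_eval_eq_zero {p : ℝ[X]}
    (h : ∀ᵐ x ∂volume.restrict (Ioo (0 : ℝ) 1), p.eval x = 0) : p = 0 := by
  by_contra hp
  have hfin : (p.rootSet ℝ).Finite := p.rootSet_finite ℝ
  have h0 : ∀ᵐ x ∂volume.restrict (Ioo (0 : ℝ) 1), x ∉ p.rootSet ℝ := by
    refine ae_restrict_of_ae ?_
    exact measure_eq_zero_iff_ae_notMem.1 (hfin.measure_zero volume)
  have hF : ∀ᵐ x ∂volume.restrict (Ioo (0 : ℝ) 1), False := by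
    filter_upwards [h, h0] with x hx hx'
    exact hx' ((mem_rootSet_of_ne hp).2 (by simpa using hx))
  rw [ae_iff] at hF
  simp at hF

theorem jacobiMoment_sq_pos {a b : ℝ} (ha : -1 < a) (hb : -1 < b) {p : ℝ[X]} (hp : p ≠ 0) :
    0 < jacobiMoment a b (p * p) := by
  have hnn : ∀ x ∈ Ioo (0 : ℝ) 1, 0 ≤ jacobiWeight a b x * (p * p).eval x := fun x hx =>
    mul_nonneg (jacobiWeight_pos a b hx).le (by rw [eval_mul]; exact mul_self_nonneg _)
  refine lt_of_le_of_ne (setIntegral_nonneg measurableSet_Ioo hnn) fun h => hp ?_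
  rw [eq_comm, jacobiMoment, setIntegral_eq_zero_iff_of_nonneg_ae
    ((ae_restrict_mem measurableSet_Ioo).mono hnn) (integrableOn_jacobiWeight_mul_eval ha hb _)] at h
  refine eq_zero_of_ae_eval_eq_zero ?_
  filter_upwards [h, ae_restrict_mem measurableSet_Ioo] with x hx hx'
  have := (mul_eq_zero.1 hx).resolve_left (jacobiWeight_pos a b hx').ne'
  rw [eval_mul] at this
  exact mul_self_eq_zero.1 this

theorem jacobiPoly_ne_zero (n : ℕ) {a b : ℝ} (hab : -2 < a + b) : jacobiPoly n a b ≠ 0 := by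
  intro h
  have := coeff_jacobiPoly_pos n a b hab
  simp [h] at this

/-- The leading coefficients do not vanish, so the top term of any polynomial can be removed by a
multiple of the Jacobi polynomial of that degree. -/
theorem span_jacobiPoly {a b : ℝ} (hab : -2 < a + b) :
    Submodule.span ℝ (range fun n => jacobiPoly n a b) = ⊤ := by
  have key : ∀ n : ℕ, ∀ p : ℝ[X], p.degree < n →
      p ∈ Submodule.span ℝ (range fun n => jacobiPoly n a b) := by
    intro n
    induction n with
    | zero =>
      intro p hp
      have : p = 0 := by
        rw [degree_lt_iff_coeff_zero] at hp
        ext m; simpa using hp m (Nat.zero_le m)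
      rw [this]; exact zero_mem _
    | succ n ih =>
      intro p hp
      set c := p.coeff n / (jacobiPoly n a b).coeff n
      have h1 : p - c • jacobiPoly n a b ∈ Submodule.span ℝ (range fun n => jacobiPoly n a b) := by
        refine ih _ ?_
        rw [degree_lt_iff_coeff_zero] at hp ⊢
        intro m hm
        rw [coeff_sub, coeff_smul]
        rcases hm.eq_or_lt with rfl | hm
        · simp [c, (coeff_jacobiPoly_pos n a b hab).ne']
        · rw [hp m hm, coeff_eq_zero_of_natDegree_lt ((natDegree_jacobiPoly_le n a b).trans_lt hm)]
          simp
      have h2 : c • jacobiPoly n a b ∈ Submodule.span ℝ (range fun n => jacobiPoly n a b) :=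
        Submodule.smul_mem _ _ (Submodule.subset_span ⟨n, rfl⟩)
      simpa using add_mem h1 h2
  rw [eq_top_iff]
  intro p _
  exact key (p.natDegree + 1) p (lt_of_le_of_lt degree_le_natDegree (by exact_mod_cast Nat.lt_succ_self _))

end Weight

/-! ### The weighted L² space and convergence of Jacobi expansions. -/

section WeightedSpace

theorem integral_jacobiMeasure (a b : ℝ) (g : ℝ → ℝ) :
    ∫ x, g x ∂jacobiMeasure a b = ∫ x in Ioo (0 : ℝ) 1, jacobiWeight a b x * g x := by
  unfold jacobiMeasure
  rw [integral_withDensity_eq_integral_toReal_smul (measurable_jacobiWeight a b).ennreal_ofReal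
    (Eventually.of_forall fun _ => ENNReal.ofReal_lt_top)]
  refine setIntegral_congr_fun measurableSet_Ioo fun x hx => ?_
  simp only [ENNReal.toReal_ofReal (jacobiWeight_pos a b hx).le, smul_eq_mul]

theorem wInner_eq_integral (a b : ℝ) (g h : ℝ → ℝ) :
    wInner a b g h = ∫ x, g x * h x ∂jacobiMeasure a b := by
  rw [integral_jacobiMeasure]
  simp only [wInner, mul_assoc]

theorem isFiniteMeasure_jacobiMeasure {a b : ℝ} (ha : -1 < a) (hb : -1 < b) :
    IsFiniteMeasure (jacobiMeasure a b) :=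
  isFiniteMeasure_withDensity_ofReal (integrableOn_jacobiWeight ha hb).2

theorem jacobiMeasure_absolutelyContinuous (a b : ℝ) :
    jacobiMeasure a b ≪ volume.restrict (Ioo (0 : ℝ) 1) :=
  withDensity_absolutelyContinuous _ _

theorem absolutelyContinuous_jacobiMeasure (a b : ℝ) :
    volume.restrict (Ioo (0 : ℝ) 1) ≪ jacobiMeasure a b := by
  refine withDensity_absolutelyContinuous' (measurable_jacobiWeight a b).ennreal_ofReal.aemeasurable ?_
  filter_upwards [ae_restrict_mem measurableSet_Ioo] with x hx
  simpa using jacobiWeight_pos a b hx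

theorem ae_mem_jacobiMeasure (a b : ℝ) : ∀ᵐ x ∂jacobiMeasure a b, x ∈ Ioo (0 : ℝ) 1 :=
  (jacobiMeasure_absolutelyContinuous a b).ae_le (ae_restrict_mem measurableSet_Ioo)

theorem integrable_jacobiMeasure_iff (a b : ℝ) (g : ℝ → ℝ) :
    Integrable g (jacobiMeasure a b) ↔
      IntegrableOn (fun x => jacobiWeight a b x * g x) (Ioo (0 : ℝ) 1) := by
  unfold jacobiMeasure
  rw [integrable_withDensity_iff_integrable_smul' (measurable_jacobiWeight a b).ennreal_ofReal
    (Eventually.of_forall fun _ => ENNReal.ofReal_lt_top)]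
  refine integrable_congr ?_
  filter_upwards [ae_restrict_mem measurableSet_Ioo] with x hx
  simp only [ENNReal.toReal_ofReal (jacobiWeight_pos a b hx).le, smul_eq_mul]

theorem restrict_le_jacobiMeasure {a b : ℝ} (ha : a ≤ 0) (hb : b ≤ 0) :
    volume.restrict (Ioo (0 : ℝ) 1) ≤ jacobiMeasure a b := by
  unfold jacobiMeasure
  nth_rewrite 1 [← withDensity_one (μ := volume.restrict (Ioo (0 : ℝ) 1))]
  refine withDensity_mono ?_
  filter_upwards [ae_restrict_mem measurableSet_Ioo] with x hx
  simpa using one_le_jacobiWeight ha hb hx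

theorem memLp_eval {a b : ℝ} (ha : -1 < a) (hb : -1 < b) (p : ℝ[X]) :
    MemLp (fun x => p.eval x) 2 (jacobiMeasure a b) := by
  have := isFiniteMeasure_jacobiMeasure ha hb
  obtain ⟨c, hc⟩ := isCompact_Icc.exists_bound_of_continuousOn (s := Icc (0 : ℝ) 1)
    p.continuous.continuousOn
  refine MemLp.of_bound p.continuous.aestronglyMeasurable c ?_
  filter_upwards [ae_mem_jacobiMeasure a b] with x hx
  exact hc x (Ioo_subset_Icc_self hx)

/-- For a finite measure, bounded continuous functions are dense in L²; Weierstrass approximation on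
[0,1] then replaces them by polynomials. -/
theorem exists_polynomial_eLpNorm_sub_le {a b : ℝ} (ha : -1 < a) (hb : -1 < b) {g : ℝ → ℝ}
    (hg : MemLp g 2 (jacobiMeasure a b)) {ε : ℝ≥0∞} (hε : ε ≠ 0) :
    ∃ p : ℝ[X], eLpNorm (fun x => g x - p.eval x) 2 (jacobiMeasure a b) ≤ ε := by
  have := isFiniteMeasure_jacobiMeasure ha hb
  have hε2 : ε / 2 ≠ 0 := (ENNReal.half_pos hε).ne'
  obtain ⟨h, hh, hhL⟩ := hg.exists_boundedContinuous_eLpNorm_sub_le (by simp) hε2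
  set M := (jacobiMeasure a b) univ ^ ((2 : ℝ≥0∞).toReal⁻¹) with hM
  have hMtop : M ≠ ⊤ := ENNReal.rpow_ne_top_of_nonneg (by simp) (measure_ne_top _ _)
  -- A uniform error δ costs at most M δ in L², with M the square root of the total mass.
  obtain ⟨δ, hδ, hδM⟩ : ∃ δ : ℝ, 0 < δ ∧ M * ENNReal.ofReal δ ≤ ε / 2 := by
    obtain ⟨d, hd0, hd⟩ := ENNReal.exists_nnreal_pos_mul_lt hMtop hε2
    refine ⟨d, by exact_mod_cast hd0, ?_⟩
    rw [ENNReal.ofReal_coe_nnreal, mul_comm]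
    exact hd.le
  obtain ⟨p, hp⟩ := exists_polynomial_near_of_continuousOn 0 1 h h.continuous.continuousOn δ hδ
  refine ⟨p, ?_⟩
  have e : (fun x => g x - p.eval x) = (g - h) + fun x => h x - p.eval x := by
    ext x; simp
  rw [e]
  refine (eLpNorm_add_le (hg.1.sub hhL.1) (hhL.1.sub (memLp_eval ha hb p).1) (by simp)).trans ?_
  rw [← ENNReal.add_halves ε]
  refine add_le_add hh ((eLpNorm_le_of_ae_bound (C := δ) ?_).trans hδM)
  filter_upwards [ae_mem_jacobiMeasure a b] with x hx
  rw [Pi.sub_apply, Real.norm_eq_abs, abs_sub_comm]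
  exact (hp x (Ioo_subset_Icc_self hx)).le

/-- A polynomial as an element of the weighted space. -/
def polyLp {a b : ℝ} (ha : -1 < a) (hb : -1 < b) : ℝ[X] →ₗ[ℝ] Lp ℝ 2 (jacobiMeasure a b) where
  toFun p := (memLp_eval ha hb p).toLp _
  map_add' p q := by
    rw [← MemLp.toLp_add]
    exact MemLp.toLp_congr _ _ (Eventually.of_forall fun x => by simp)
  map_smul' c p := by
    rw [RingHom.id_apply, ← MemLp.toLp_const_smul]
    exact MemLp.toLp_congr _ _ (Eventually.of_forall fun x => by simp)

theorem inner_toLp {a b : ℝ} {g h : ℝ → ℝ} (hg : MemLp g 2 (jacobiMeasure a b))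
    (hh : MemLp h 2 (jacobiMeasure a b)) :
    inner ℝ (hg.toLp g) (hh.toLp h) = wInner a b g h := by
  rw [L2.inner_def, wInner_eq_integral]
  refine integral_congr_ae ?_
  filter_upwards [hg.coeFn_toLp, hh.coeFn_toLp] with x h1 h2
  rw [h1, h2]
  simp [mul_comm]

theorem inner_polyLp {a b : ℝ} (ha : -1 < a) (hb : -1 < b) (p q : ℝ[X]) :
    inner ℝ (polyLp ha hb p) (polyLp ha hb q) = jacobiMoment a b (p * q) := by
  refine (inner_toLp (memLp_eval ha hb p) (memLp_eval ha hb q)).trans ?_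
  simp only [wInner, jacobiMoment, eval_mul, mul_assoc]

theorem denseRange_polyLp {a b : ℝ} (ha : -1 < a) (hb : -1 < b) : DenseRange (polyLp ha hb) := by
  rw [Metric.denseRange_iff]
  intro g ε hε
  obtain ⟨p, hp⟩ := exists_polynomial_eLpNorm_sub_le ha hb (Lp.memLp g)
    (ε := ENNReal.ofReal (ε / 2)) (by simpa using hε)
  refine ⟨p, ?_⟩
  have hg : g = (Lp.memLp g).toLp _ := (Lp.toLp_coeFn g _).symm
  rw [hg]
  change dist _ ((memLp_eval ha hb p).toLp _) < ε
  rw [dist_eq_norm, ← MemLp.toLp_sub, Lp.norm_toLp]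
  refine lt_of_le_of_lt (ENNReal.toReal_le_of_le_ofReal (by linarith) hp) (by linarith)

/-- Orthogonality together with density of polynomials makes the normalised Jacobi polynomials a
Hilbert basis; the two normalising factors combine into the quotient by the squared norm. -/
theorem tendsto_jacobi_expansion {a b : ℝ} (ha : -1 < a) (hb : -1 < b) {g : ℝ → ℝ}
    (hg : MemLp g 2 (jacobiMeasure a b)) :
    Tendsto (fun N => eLpNorm (fun x => (∑ j ∈ Finset.range N,
      wInner a b g (jacobiG j a b) / wInner a b (jacobiG j a b) (jacobiG j a b) * jacobiG j a b x) -
        g x) 2 (jacobiMeasure a b)) atTop (𝓝 0) := by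
  have hab : -2 < a + b := by linarith
  set e : ℕ → Lp ℝ 2 (jacobiMeasure a b) := fun n => polyLp ha hb (jacobiPoly n a b) with he
  have horth : ∀ m n, m ≠ n → inner ℝ (e m) (e n) = 0 := fun m n hmn => by
    rw [he, inner_polyLp, jacobiMoment_orthogonal ha hb hmn]
  have hne : ∀ n, e n ≠ 0 := fun n h => by
    have h1 : inner ℝ (e n) (e n) = 0 := by rw [h, inner_zero_left]
    rw [he, inner_polyLp] at h1
    exact (jacobiMoment_sq_pos ha hb (jacobiPoly_ne_zero n hab)).ne' h1
  have hon : Orthonormal ℝ fun n => ‖e n‖⁻¹ • e n := by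
    refine ⟨fun n => ?_, fun m n hmn => ?_⟩
    · rw [norm_smul, norm_inv, norm_norm, inv_mul_cancel₀ (norm_ne_zero_iff.2 (hne n))]
    · simp only [inner_smul_left, inner_smul_right, horth m n hmn, mul_zero]
  have hspan : ⊤ ≤ (Submodule.span ℝ (range fun n => ‖e n‖⁻¹ • e n)).topologicalClosure := by
    have h1 : LinearMap.range (polyLp ha hb) ≤ Submodule.span ℝ (range fun n => ‖e n‖⁻¹ • e n) := by
      rw [LinearMap.range_eq_map, ← span_jacobiPoly hab, Submodule.map_span, Submodule.span_le]
      rintro _ ⟨_, ⟨n, rfl⟩, rfl⟩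
      have : polyLp ha hb (jacobiPoly n a b) = ‖e n‖ • (‖e n‖⁻¹ • e n) := by
        rw [smul_smul, mul_inv_cancel₀ (norm_ne_zero_iff.2 (hne n)), one_smul]
      rw [SetLike.mem_coe]
      change polyLp ha hb (jacobiPoly n a b) ∈ _
      rw [this]
      exact Submodule.smul_mem _ _ (Submodule.subset_span ⟨n, rfl⟩)
    intro g _
    refine Submodule.topologicalClosure_mono h1 ?_
    have := denseRange_polyLp ha hb g
    rwa [← LinearMap.coe_range] at this
  set B := HilbertBasis.mk hon hspan
  have hs := (B.hasSum_repr (hg.toLp g)).tendsto_sum_nat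
  have hterm : ∀ n, B.repr (hg.toLp g) n • B n =
      polyLp ha hb (C (wInner a b g (jacobiG n a b) /
        wInner a b (jacobiG n a b) (jacobiG n a b)) * jacobiPoly n a b) := by
    intro n
    have hB : B n = ‖e n‖⁻¹ • e n := by simp [B]
    rw [HilbertBasis.repr_apply_apply, hB, inner_smul_left, smul_smul, ← smul_eq_C_mul, map_smul]
    have hG : (fun x => (jacobiPoly n a b).eval x) = jacobiG n a b := by
      ext x; exact eval_jacobiPoly n a b x
    have h1 : inner ℝ (e n) (hg.toLp g) = wInner a b g (jacobiG n a b) := by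
      rw [real_inner_comm, ← hG]
      exact inner_toLp hg (memLp_eval ha hb _)
    have h2 : wInner a b (jacobiG n a b) (jacobiG n a b) = ‖e n‖ * ‖e n‖ := by
      rw [← real_inner_self_eq_norm_mul_norm, ← hG]
      exact (inner_toLp (memLp_eval ha hb _) (memLp_eval ha hb _)).symm
    rw [h1, h2]
    congr 1
    simp only [conj_trivial]
    field_simp
  simp only [hterm, ← map_sum] at hs
  have hs' := (Lp.tendsto_Lp_iff_tendsto_eLpNorm'' _
    (fun N => memLp_eval ha hb (∑ j ∈ Finset.range N, (C (wInner a b g (jacobiG j a b) /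
        wInner a b (jacobiG j a b) (jacobiG j a b)) * jacobiPoly j a b))) g hg).1 hs
  refine hs'.congr fun N => ?_
  congr 1; ext x
  simp [eval_finsetSum, eval_jacobiPoly]

end WeightedSpace

/-! ### Euler integrals and the constancy of the two-sided Abel integral of the weight. -/

section EulerIntegral

theorem one_sub_mul_pos {x v : ℝ} (hx : x ≤ 1) (hv : v ∈ Ioo (0 : ℝ) 1) : 0 < 1 - x * v := by
  nlinarith [hv.1, hv.2]

/-- Euler's integral, in the case in which it reduces to the beta function. -/
theorem integral_jacobiWeight_mul_rpow_neg {p q x : ℝ} (hp : 0 < p) (hq : 0 < q)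
    (hx : x ∈ Ioo (0 : ℝ) 1) :
    ∫ v in Ioo (0 : ℝ) 1, jacobiWeight (q - 1) (p - 1) v * (1 - x * v) ^ (-(p + q)) =
      (1 - x) ^ (-p) * ProbabilityTheory.beta p q := by
  have hc : 0 < 1 - x := sub_pos.2 hx.2
  have hD : ∀ y ∈ Ioo (0 : ℝ) 1, 0 < 1 - x + x * y := fun y hy => by
    have := mul_pos hx.1 hy.1; linarith
  -- The substitution v = y/(1-x+xy) maps (0,1) onto itself, with 1 - xv = (1-x)/(1-x+xy). For the
  -- exponent -(p+q), all powers of 1-x+xy, including those of the Jacobian, cancel.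
  have hderiv : ∀ y ∈ Ioo (0 : ℝ) 1, HasDerivWithinAt (fun y : ℝ => y / (1 - x + x * y))
      ((1 - x) / (1 - x + x * y) ^ 2) (Ioo 0 1) y := by
    intro y hy
    have h1 : HasDerivAt (fun y : ℝ => 1 - x + x * y) x y := by
      simpa using ((hasDerivAt_id y).const_mul x).const_add (1 - x)
    refine (((hasDerivAt_id y).div h1 (hD y hy).ne').congr_deriv ?_).hasDerivWithinAt
    simp only [id]
    congr 1
    ring
  have hinj : InjOn (fun y : ℝ => y / (1 - x + x * y)) (Ioo 0 1) := by
    intro y hy z hz h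
    simp only at h
    rw [div_eq_div_iff (hD y hy).ne' (hD z hz).ne'] at h
    have : (1 - x) * (y - z) = 0 := by linear_combination h
    have := (mul_eq_zero.1 this).resolve_left hc.ne'
    linarith
  have himg : (fun y : ℝ => y / (1 - x + x * y)) '' Ioo 0 1 = Ioo 0 1 := by
    ext v
    constructor
    · rintro ⟨y, hy, rfl⟩
      have := hD y hy
      refine ⟨div_pos hy.1 this, (div_lt_one this).2 ?_⟩
      nlinarith [hy.1, hy.2]
    · intro hv
      have h1 := one_sub_mul_pos hx.2.le hv
      refine ⟨(1 - x) * v / (1 - x * v), ⟨div_pos (mul_pos hc hv.1) h1, (div_lt_one h1).2 ?_⟩, ?_⟩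
      · nlinarith [hv.1, hv.2]
      · have h2 : 1 - x + x * ((1 - x) * v / (1 - x * v)) = (1 - x) / (1 - x * v) := by
          field_simp; ring
        simp only [h2]
        field_simp
  have h := integral_image_eq_integral_abs_deriv_smul measurableSet_Ioo hderiv hinj
    (fun v => jacobiWeight (q - 1) (p - 1) v * (1 - x * v) ^ (-(p + q)))
  rw [himg] at h
  rw [h, ← integral_jacobiWeight hp hq, ← integral_const_mul]
  refine setIntegral_congr_fun measurableSet_Ioo fun y hy => ?_
  have hDy := hD y hy
  have hy1 : 0 < 1 - y := sub_pos.2 hy.2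
  have e1 : 1 - y / (1 - x + x * y) = (1 - x) * (1 - y) / (1 - x + x * y) := by
    rw [eq_div_iff hDy.ne', sub_mul, div_mul_cancel₀ _ hDy.ne']; ring
  have e2 : 1 - x * (y / (1 - x + x * y)) = (1 - x) / (1 - x + x * y) := by field_simp; ring
  have ec : (1 - x) ^ (-(p + q)) = (1 - x) ^ (-p) * ((1 - x) ^ (q - 1) * (1 - x))⁻¹ := by
    rw [← Real.rpow_add_one hc.ne', sub_add_cancel, ← Real.rpow_neg hc.le, ← Real.rpow_add hc]
    congr 1; ring
  have eD : (1 - x + x * y) ^ (-(p + q)) = ((1 - x + x * y) ^ (q - 1) * (1 - x + x * y) ^ (p - 1) *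
      (1 - x + x * y) ^ 2)⁻¹ := by
    rw [← Real.rpow_two, ← Real.rpow_add hDy, ← Real.rpow_add hDy, ← Real.rpow_neg hDy.le]
    congr 1; ring
  simp only [smul_eq_mul, jacobiWeight]
  rw [abs_of_pos (by positivity), e1, e2, Real.div_rpow (by positivity) hDy.le,
    Real.div_rpow hy.1.le hDy.le, Real.div_rpow hc.le hDy.le, Real.mul_rpow hc.le hy1.le, ec, eD]
  have hq' : (0 : ℝ) < (1 - x) ^ (q - 1) := Real.rpow_pos_of_pos hc _
  have hD1 : (0 : ℝ) < (1 - x + x * y) ^ (q - 1) := Real.rpow_pos_of_pos hDy _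
  have hD2 : (0 : ℝ) < (1 - x + x * y) ^ (p - 1) := Real.rpow_pos_of_pos hDy _
  field_simp

/-- The Euler integral `∫₀¹ v^{b-1} (1-v)^{1-a-b} (1-xv)^{a-1} dv`. -/
def eulerInt (a b x : ℝ) : ℝ :=
  ∫ v in Ioo (0 : ℝ) 1, jacobiWeight (1 - a - b) (b - 1) v * (1 - x * v) ^ (a - 1)

theorem integrableOn_jacobiWeight_mul_rpow {p q x : ℝ} (hp : -1 < p) (hq : -1 < q) (c : ℝ)
    (hx₀ : 0 ≤ x) (hx : x < 1) :
    IntegrableOn (fun v => jacobiWeight p q v * (1 - x * v) ^ c) (Ioo (0 : ℝ) 1) := by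
  refine integrableOn_mul_of_continuousOn_Icc (integrableOn_jacobiWeight hp hq) ?_
  refine ContinuousOn.rpow_const (by fun_prop) fun v hv => Or.inl ?_
  nlinarith [hv.1, hv.2]

theorem hasDerivAt_eulerInt {a b x : ℝ} (ha : a ≤ 1) (hb : 0 < b) (hab : a + b < 2)
    (hx : x ∈ Ioo (0 : ℝ) 1) :
    HasDerivAt (eulerInt a b) (∫ v in Ioo (0 : ℝ) 1, jacobiWeight (1 - a - b) (b - 1) v *
      ((1 - a) * v * (1 - x * v) ^ (a - 2))) x := by
  have hδ : 0 < (1 - x) / 2 := half_pos (sub_pos.2 hx.2)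
  have hw := integrableOn_jacobiWeight (a := 1 - a - b) (b := b - 1) (by linarith) (by linarith)
  -- For y in this neighbourhood and v in (0,1), 1 - yv ≥ (1-x)/2, which gives a dominating function
  -- independent of y.
  have hs : Ioo (0 : ℝ) ((1 + x) / 2) ∈ 𝓝 x := Ioo_mem_nhds hx.1 (by linarith [hx.2])
  have hmeas : ∀ (x c : ℝ), AEStronglyMeasurable (fun v => (1 - x * v) ^ c)
      (volume.restrict (Ioo (0 : ℝ) 1)) := fun x c => by
    have : Measurable fun v : ℝ => (1 - x * v) ^ c := by fun_prop
    exact this.aestronglyMeasurable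
  refine (hasDerivAt_integral_of_dominated_loc_of_deriv_le hs
    (bound := fun v => jacobiWeight (1 - a - b) (b - 1) v * ((1 - a) * ((1 - x) / 2) ^ (a - 2)))
    (Eventually.of_forall fun y => hw.1.mul (hmeas y _))
    (integrableOn_jacobiWeight_mul_rpow (by linarith) (by linarith) _ hx.1.le hx.2)
    (F' := fun x v => jacobiWeight (1 - a - b) (b - 1) v * ((1 - a) * v * (1 - x * v) ^ (a - 2)))
    (hw.1.mul (AEStronglyMeasurable.mul (by fun_prop) (hmeas x _))) ?_ (hw.mul_const _) ?_).2
  · filter_upwards [ae_restrict_mem measurableSet_Ioo] with v hv y hy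
    have h1 : (1 - x) / 2 ≤ 1 - y * v := by nlinarith [hv.1, hv.2, hy.1, hy.2]
    have h2 := Real.rpow_le_rpow_of_nonpos hδ h1 (show a - 2 ≤ 0 by linarith)
    have h3 : 0 < 1 - y * v := hδ.trans_le h1
    have h4 := Real.rpow_nonneg h3.le (a - 2)
    have h5 : (0 : ℝ) ≤ 1 - a := by linarith
    rw [norm_mul, Real.norm_of_nonneg (jacobiWeight_pos _ _ hv).le, Real.norm_of_nonneg
      (mul_nonneg (mul_nonneg h5 hv.1.le) h4), mul_assoc (1 - a)]
    refine mul_le_mul_of_nonneg_left (mul_le_mul_of_nonneg_left ?_ h5) (jacobiWeight_pos _ _ hv).le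
    exact (mul_le_of_le_one_left h4 hv.2.le).trans h2
  · filter_upwards [ae_restrict_mem measurableSet_Ioo] with v hv y hy
    have h3 : 0 < 1 - y * v := one_sub_mul_pos (by linarith [hy.2, hx.2]) hv
    have h1 : HasDerivAt (fun y : ℝ => 1 - y * v) (-v) y := by
      simpa using ((hasDerivAt_id y).mul_const v).const_sub 1
    refine ((h1.rpow_const (p := a - 1) (Or.inl h3.ne')).const_mul _).congr_deriv ?_
    rw [show a - 1 - 1 = a - 2 by ring]
    ring

/-- The product rule produces (1-xv)^{a-1} + xv(1-xv)^{a-2} = (1-xv)^{a-2} under the integral. This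
exponent is -(p+q) for p = b, q = 2-a-b, the case with a closed form. -/
theorem hasDerivAt_rpow_mul_eulerInt {a b x : ℝ} (ha : a ≤ 1) (hb : 0 < b) (hab : a + b < 2)
    (hx : x ∈ Ioo (0 : ℝ) 1) :
    HasDerivAt (fun x => x ^ (1 - a) * eulerInt a b x)
      ((1 - a) * ProbabilityTheory.beta b (2 - a - b) * (x ^ (-a) * (1 - x) ^ (-b))) x := by
  have h1 : HasDerivAt (fun x : ℝ => x ^ (1 - a)) ((1 - a) * x ^ (-a)) x := by
    refine ((hasDerivAt_id x).rpow_const (p := 1 - a) (Or.inl hx.1.ne')).congr_deriv ?_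
    rw [show 1 - a - 1 = -a by ring]; simp
  refine (h1.mul (hasDerivAt_eulerInt ha hb hab hx)).congr_deriv ?_
  have hM := integral_jacobiWeight_mul_rpow_neg hb (show 0 < 2 - a - b by linarith) hx
  rw [show 2 - a - b - 1 = 1 - a - b by ring, show -(b + (2 - a - b)) = a - 2 by ring] at hM
  have hi1 := integrableOn_jacobiWeight_mul_rpow (p := 1 - a - b) (q := b - 1) (by linarith)
    (by linarith) (a - 1) hx.1.le hx.2
  have hi2 : IntegrableOn (fun v => x * (v * (jacobiWeight (1 - a - b) (b - 1) v *
      (1 - x * v) ^ (a - 2)))) (Ioo (0 : ℝ) 1) := by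
    have h := integrableOn_mul_of_continuousOn_Icc (integrableOn_jacobiWeight_mul_rpow
      (p := 1 - a - b) (q := b - 1) (by linarith) (by linarith) (a - 2) hx.1.le hx.2)
      (h := fun v => x * v) (by fun_prop)
    refine h.congr (Eventually.of_forall fun v => ?_)
    simp only; ring
  have hsum : eulerInt a b x + ∫ v in Ioo (0 : ℝ) 1,
      x * (v * (jacobiWeight (1 - a - b) (b - 1) v * (1 - x * v) ^ (a - 2))) =
      (1 - x) ^ (-b) * ProbabilityTheory.beta b (2 - a - b) := by
    rw [← hM, eulerInt, ← integral_add hi1 hi2]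
    refine setIntegral_congr_fun measurableSet_Ioo fun v hv => ?_
    have h3 : 0 < 1 - x * v := one_sub_mul_pos hx.2.le hv
    have : (1 - x * v) ^ (a - 1) = (1 - x * v) ^ (a - 2) * (1 - x * v) := by
      rw [← Real.rpow_add_one h3.ne']; congr 1; ring
    simp only [this]; ring
  have hI : ∫ v in Ioo (0 : ℝ) 1, jacobiWeight (1 - a - b) (b - 1) v *
      ((1 - a) * v * (1 - x * v) ^ (a - 2)) = (1 - a) * ∫ v in Ioo (0 : ℝ) 1,
      v * (jacobiWeight (1 - a - b) (b - 1) v * (1 - x * v) ^ (a - 2)) := by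
    rw [← integral_const_mul]; congr 1; ext v; ring
  rw [integral_const_mul] at hsum
  have hxa : x ^ (1 - a) = x ^ (-a) * x := by
    rw [← Real.rpow_add_one hx.1.ne']; congr 1; ring
  rw [hI, hxa]
  linear_combination ((1 - a) * x ^ (-a)) * hsum

/-- Since a ≤ 1, the integrand is largest at x = 1, where it equals v^{b-1}(1-v)^{-b}; this is
integrable because 0 < b < 1. -/
theorem continuousOn_eulerInt {a b : ℝ} (ha : a ≤ 1) (hb₀ : 0 < b) (hb₁ : b < 1) :
    ContinuousOn (eulerInt a b) (Icc 0 1) := by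
  refine continuousOn_of_dominated (bound := jacobiWeight (-b) (b - 1)) (fun x _ => ?_)
    (fun x hx => ?_) (integrableOn_jacobiWeight (by linarith) (by linarith)) ?_
  · have : Measurable fun v : ℝ => (1 - x * v) ^ (a - 1) := by fun_prop
    exact ((measurable_jacobiWeight _ _).mul this).aestronglyMeasurable
  · filter_upwards [ae_restrict_mem measurableSet_Ioo] with v hv
    have h1 : 0 < 1 - v := sub_pos.2 hv.2
    have h2 : 1 - v ≤ 1 - x * v := by nlinarith [hv.1, hx.2]
    have h3 := Real.rpow_le_rpow_of_nonpos h1 h2 (show a - 1 ≤ 0 by linarith)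
    have h4 : 0 < 1 - x * v := one_sub_mul_pos hx.2 hv
    rw [Real.norm_of_nonneg (mul_nonneg (jacobiWeight_pos _ _ hv).le (Real.rpow_nonneg h4.le _))]
    have e : jacobiWeight (-b) (b - 1) v = jacobiWeight (1 - a - b) (b - 1) v * (1 - v) ^ (a - 1) := by
      unfold jacobiWeight
      rw [mul_right_comm, ← Real.rpow_add h1]
      congr 2; ring
    rw [e]
    exact mul_le_mul_of_nonneg_left h3 (jacobiWeight_pos _ _ hv).le
  · filter_upwards [ae_restrict_mem measurableSet_Ioo] with v hv
    refine continuousOn_const.mul (ContinuousOn.rpow_const (by fun_prop) fun x hx => Or.inl ?_)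
    exact (one_sub_mul_pos hx.2 hv).ne'

theorem beta_one_sub {b : ℝ} : ProbabilityTheory.beta b (1 - b) =
    Real.pi / Real.sin (Real.pi * b) := by
  rw [ProbabilityTheory.beta, Real.Gamma_mul_Gamma_one_sub, add_sub_cancel, Real.Gamma_one, div_one]

theorem eulerInt_one {a b : ℝ} (hb₀ : 0 < b) (hb₁ : b < 1) :
    eulerInt a b 1 = Real.pi / Real.sin (Real.pi * b) := by
  rw [← beta_one_sub, ← integral_jacobiWeight hb₀ (sub_pos.2 hb₁), eulerInt]
  refine setIntegral_congr_fun measurableSet_Ioo fun v hv => ?_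
  have h1 : 0 < 1 - v := sub_pos.2 hv.2
  simp only [jacobiWeight, one_mul]
  rw [mul_right_comm, ← Real.rpow_add h1]
  congr 2; ring

theorem eulerInt_one_left {b x : ℝ} (hb₀ : 0 < b) (hb₁ : b < 1) :
    eulerInt 1 b x = Real.pi / Real.sin (Real.pi * b) := by
  rw [← beta_one_sub, ← integral_jacobiWeight hb₀ (sub_pos.2 hb₁), eulerInt]
  simp [show 1 - b - 1 = -b by ring]

theorem sin_pi_mul_pos {b : ℝ} (hb₀ : 0 < b) (hb₁ : b < 1) : 0 < Real.sin (Real.pi * b) :=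
  Real.sin_pos_of_pos_of_lt_pi (by positivity) (by nlinarith [Real.pi_pos])

/-- The right-hand side is symmetric in a and b. This symmetry cancels the derivatives of the left
and right fractional integrals; it comes from the reflection formula for Γ. -/
theorem sin_mul_beta {a b : ℝ} (ha₁ : a < 1) (hb₀ : 0 < b) (hb₁ : b < 1) :
    Real.sin (Real.pi * b) * ((1 - a) * ProbabilityTheory.beta b (2 - a - b)) =
      Real.pi * Real.Gamma (2 - a - b) / (Real.Gamma (1 - a) * Real.Gamma (1 - b)) := by
  have h1 := Real.Gamma_mul_Gamma_one_sub b
  have h2 : Real.Gamma (2 - a) = (1 - a) * Real.Gamma (1 - a) := by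
    rw [← Real.Gamma_add_one (by linarith)]; congr 1; ring
  have hs := sin_pi_mul_pos hb₀ hb₁
  have g1 := Real.Gamma_pos_of_pos (show 0 < 1 - a by linarith)
  have g2 := Real.Gamma_pos_of_pos (show 0 < 1 - b by linarith)
  have ha : 0 < 1 - a := by linarith
  rw [eq_div_iff hs.ne'] at h1
  rw [ProbabilityTheory.beta, show b + (2 - a - b) = 2 - a by ring, h2]
  field_simp
  linear_combination (Real.Gamma (2 - a - b)) * h1

/-- The two-sided Abel integral of the weight `ω^{(a-1,b-1)}` is constant. -/
theorem sin_mul_eulerInt_add {a b x : ℝ} (ha₀ : 0 < a) (ha₁ : a ≤ 1) (hb₀ : 0 < b) (hb₁ : b ≤ 1)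
    (hab : a + b < 2) (hx : x ∈ Ioo (0 : ℝ) 1) :
    Real.sin (Real.pi * b) * (x ^ (1 - a) * eulerInt a b x) +
      Real.sin (Real.pi * a) * ((1 - x) ^ (1 - b) * eulerInt b a (1 - x)) = Real.pi := by
  -- When a = 1 or b = 1, one sine vanishes and the remaining Euler integral is constant, so the
  -- identity is immediate.
  rcases ha₁.eq_or_lt with rfl | ha₁'
  · have hb : b < 1 := by linarith
    have hs := sin_pi_mul_pos hb₀ hb
    rw [eulerInt_one_left hb₀ hb]
    simp; field_simp
  rcases hb₁.eq_or_lt with rfl | hb₁'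
  · have hs := sin_pi_mul_pos ha₀ ha₁'
    rw [eulerInt_one_left ha₀ ha₁']
    simp; field_simp
  -- H is continuous on [0,1] with zero derivative inside, hence equal to H 0. There the first term
  -- vanishes and the second is sin(πa) · π / sin(πa).
  set H : ℝ → ℝ := fun x => Real.sin (Real.pi * b) * (x ^ (1 - a) * eulerInt a b x) +
      Real.sin (Real.pi * a) * ((1 - x) ^ (1 - b) * eulerInt b a (1 - x)) with hH
  have hcont : ContinuousOn H (Icc 0 1) := by
    have h1 := continuousOn_eulerInt ha₁ hb₀ hb₁'
    have h2 : ContinuousOn (fun x => eulerInt b a (1 - x)) (Icc 0 1) :=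
      (continuousOn_eulerInt hb₁ ha₀ ha₁').comp (by fun_prop)
        fun y hy => ⟨by linarith [hy.2], by linarith [hy.1]⟩
    have h3 : Continuous fun x : ℝ => x ^ (1 - a) :=
      continuous_id.rpow_const fun _ => Or.inr (by linarith)
    have h4 : Continuous fun x : ℝ => (1 - x) ^ (1 - b) :=
      (continuous_const.sub continuous_id).rpow_const fun _ => Or.inr (by linarith)
    exact (continuousOn_const.mul (h3.continuousOn.mul h1)).add
      (continuousOn_const.mul (h4.continuousOn.mul h2))
  have hder : ∀ y ∈ Ioo (0 : ℝ) 1, HasDerivAt H 0 y := by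
    intro y hy
    have hy' : 1 - y ∈ Ioo (0 : ℝ) 1 := ⟨by linarith [hy.2], by linarith [hy.1]⟩
    have h1 := hasDerivAt_rpow_mul_eulerInt ha₁ hb₀ hab hy
    have h2 := (hasDerivAt_rpow_mul_eulerInt hb₁ ha₀ (by linarith) hy').scomp y
      ((hasDerivAt_id y).const_sub 1)
    refine ((h1.const_mul _).add (h2.const_mul _)).congr_deriv ?_
    have c1 := sin_mul_beta ha₁' hb₀ hb₁'
    have c2 := sin_mul_beta hb₁' ha₀ ha₁'
    rw [show 2 - b - a = 2 - a - b by ring, mul_comm (Real.Gamma (1 - b))] at c2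
    rw [show 2 - b - a = 2 - a - b by ring, sub_sub_cancel]
    simp only [smul_eq_mul]
    linear_combination (y ^ (-a) * (1 - y) ^ (-b)) * (c1 - c2)
  obtain ⟨c, hc, hcx⟩ := exists_hasDerivAt_eq_slope H (fun _ => 0) hx.1
    (hcont.mono (Icc_subset_Icc_right hx.2.le)) (fun y hy => hder y ⟨hy.1, hy.2.trans hx.2⟩)
  have hx0 : H x = H 0 := by
    have hxne := hx.1.ne'
    rw [sub_zero, eq_comm, div_eq_zero_iff] at hcx
    have := hcx.resolve_right hxne
    linarith
  have hs := sin_pi_mul_pos ha₀ ha₁'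
  have h0 : H 0 = Real.pi := by
    simp only [hH, Real.zero_rpow (show 1 - a ≠ 0 by linarith), sub_zero, eulerInt_one ha₀ ha₁']
    simp; field_simp
  exact hx0.trans h0

end EulerIntegral

/-! ### The two-sided kernel and its action on weighted polynomials. -/

section Kernel

/-- The admissible pairs of exponents `(a, b) = (α - β, β)`. -/
structure Admissible (a b : ℝ) : Prop where
  pos_left : 0 < a
  left_le : a ≤ 1
  pos_right : 0 < b
  right_le : b ≤ 1
  one_lt : 1 < a + b
  lt_two : a + b < 2

theorem Admissible.symm {a b : ℝ} (h : Admissible a b) : Admissible b a :=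
  ⟨h.pos_right, h.right_le, h.pos_left, h.left_le, by linarith [h.one_lt], by linarith [h.lt_two]⟩

theorem sin_pi_mul_nonneg {b : ℝ} (hb₀ : 0 < b) (hb₁ : b ≤ 1) : 0 ≤ Real.sin (Real.pi * b) :=
  Real.sin_nonneg_of_nonneg_of_le_pi (by positivity) (by nlinarith [Real.pi_pos])

theorem Admissible.sin_add_sin_pos {a b : ℝ} (h : Admissible a b) :
    0 < Real.sin (Real.pi * a) + Real.sin (Real.pi * b) := by
  have h1 := sin_pi_mul_nonneg h.pos_left h.left_le
  have h2 := sin_pi_mul_nonneg h.pos_right h.right_le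
  rcases lt_or_ge a 1 with ha | ha
  · linarith [sin_pi_mul_pos h.pos_left ha]
  · linarith [sin_pi_mul_pos h.pos_right (show b < 1 by linarith [h.lt_two])]

/-- The coefficient `r` as a function of `a = α - β` and `b = β`. -/
def skewness (a b : ℝ) : ℝ :=
  Real.sin (Real.pi * b) / (Real.sin (Real.pi * a) + Real.sin (Real.pi * b))

theorem Admissible.skewness_nonneg {a b : ℝ} (h : Admissible a b) : 0 ≤ skewness a b :=
  div_nonneg (sin_pi_mul_nonneg h.pos_right h.right_le) h.sin_add_sin_pos.le

/-- Exchanging r and 1 - r amounts to exchanging a and b, so the transposed operator belongs to the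
same family. -/
theorem Admissible.one_sub_skewness {a b : ℝ} (h : Admissible a b) :
    1 - skewness a b = skewness b a := by
  have := h.sin_add_sin_pos
  unfold skewness
  rw [add_comm (Real.sin (Real.pi * b)), eq_div_iff this.ne', sub_mul, div_mul_cancel₀ _ this.ne']
  ring

/-- The kernel of the two-sided fractional integral, without the factor `1 / Γ(2 - α)`. -/
def kern (a b z : ℝ) : ℝ :=
  skewness a b * (if 0 < z then z ^ (1 - a - b) else 0) +
    skewness b a * (if z < 0 then (-z) ^ (1 - a - b) else 0)

theorem kern_neg (a b z : ℝ) : kern a b (-z) = kern b a z := by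
  unfold kern
  simp only [Left.neg_pos_iff, Left.neg_neg_iff, neg_neg]
  rw [add_comm, show 1 - a - b = 1 - b - a by ring]

theorem kern_of_pos (a b : ℝ) {z : ℝ} (hz : 0 < z) : kern a b z = skewness a b * z ^ (1 - a - b) := by
  simp [kern, hz, hz.not_gt]

theorem kern_of_neg (a b : ℝ) {z : ℝ} (hz : z < 0) :
    kern a b z = skewness b a * (-z) ^ (1 - a - b) := by
  simp [kern, hz, hz.not_gt]

theorem Admissible.kern_nonneg {a b : ℝ} (h : Admissible a b) (z : ℝ) : 0 ≤ kern a b z := by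
  rcases lt_trichotomy z 0 with hz | rfl | hz
  · rw [kern_of_neg a b hz]
    exact mul_nonneg h.symm.skewness_nonneg (Real.rpow_nonneg (by linarith) _)
  · simp [kern]
  · rw [kern_of_pos a b hz]
    exact mul_nonneg h.skewness_nonneg (Real.rpow_nonneg hz.le _)

theorem measurable_kern (a b : ℝ) : Measurable (kern a b) := by
  unfold kern
  refine (Measurable.const_mul (Measurable.ite measurableSet_Ioi (by fun_prop) measurable_const) _).add
    (Measurable.const_mul (Measurable.ite measurableSet_Iio (by fun_prop) measurable_const) _)

theorem integral_mul_kern {a b x : ℝ} {w : ℝ → ℝ} (hx : x ∈ Ioo (0 : ℝ) 1)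
    (hl : IntervalIntegrable (fun s => w s * (x - s) ^ (1 - a - b)) volume 0 x)
    (hr : IntervalIntegrable (fun s => w s * (s - x) ^ (1 - a - b)) volume x 1) :
    IntegrableOn (fun s => w s * kern a b (x - s)) (Ioo (0 : ℝ) 1) ∧
    ∫ s in Ioo (0 : ℝ) 1, w s * kern a b (x - s) =
      skewness a b * (∫ s in (0 : ℝ)..x, w s * (x - s) ^ (1 - a - b)) +
      skewness b a * ∫ s in x..(1 : ℝ), w s * (s - x) ^ (1 - a - b) := by
  have el : ∀ s ∈ Ioo 0 x, skewness a b * (w s * (x - s) ^ (1 - a - b)) = w s * kern a b (x - s) := by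
    intro s hs
    rw [kern_of_pos a b (sub_pos.2 hs.2)]; ring
  have er : ∀ s ∈ Ioo x 1, skewness b a * (w s * (s - x) ^ (1 - a - b)) = w s * kern a b (x - s) := by
    intro s hs
    rw [kern_of_neg a b (sub_neg.2 hs.1), neg_sub]; ring
  have hl' : IntervalIntegrable (fun s => w s * kern a b (x - s)) volume 0 x :=
    (hl.const_mul (skewness a b)).congr_uIoo (by rwa [uIoo_of_le hx.1.le])
  have hr' : IntervalIntegrable (fun s => w s * kern a b (x - s)) volume x 1 :=
    (hr.const_mul (skewness b a)).congr_uIoo (by rwa [uIoo_of_le hx.2.le])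
  refine ⟨(intervalIntegrable_iff_integrableOn_Ioo_of_le zero_le_one).1 (hl'.trans hr'), ?_⟩
  rw [← integral_Ioc_eq_integral_Ioo, ← intervalIntegral.integral_of_le zero_le_one,
    ← intervalIntegral.integral_add_adjacent_intervals hl' hr',
    ← intervalIntegral.integral_const_mul, ← intervalIntegral.integral_const_mul,
    intervalIntegral.integral_congr_Ioo_of_le hx.1.le el,
    intervalIntegral.integral_congr_Ioo_of_le hx.2.le er]

theorem jacobiWeight_mul_rpow_scaled {a b x v : ℝ} (hx : x ∈ Ioo (0 : ℝ) 1) (hv : v ∈ Ioo (0 : ℝ) 1) :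
    jacobiWeight (a - 1) (b - 1) (x * v) * (x - x * v) ^ (1 - a - b) =
      x ^ (-a) * (jacobiWeight (1 - a - b) (b - 1) v * (1 - x * v) ^ (a - 1)) := by
  have h1 : 0 < 1 - v := sub_pos.2 hv.2
  have e : x ^ (-a) = x ^ (b - 1) * x ^ (1 - a - b) := by
    rw [← Real.rpow_add hx.1]; congr 1; ring
  unfold jacobiWeight
  rw [show x - x * v = x * (1 - v) by ring, Real.mul_rpow hx.1.le h1.le,
    Real.mul_rpow hx.1.le hv.1.le, e]
  ring

/-- The scaling s = xv carries the integral to (0,1); the powers of x combine to x^{-a}, times the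
Jacobian x. -/
theorem Admissible.left_integral {a b x : ℝ} (h : Admissible a b) (hx : x ∈ Ioo (0 : ℝ) 1) :
    IntervalIntegrable (fun s => jacobiWeight (a - 1) (b - 1) s * (x - s) ^ (1 - a - b)) volume 0 x ∧
    ∫ s in (0 : ℝ)..x, jacobiWeight (a - 1) (b - 1) s * (x - s) ^ (1 - a - b) =
      x ^ (1 - a) * eulerInt a b x := by
  have hi := integrableOn_jacobiWeight_mul_rpow (p := 1 - a - b) (q := b - 1)
    (by linarith [h.lt_two]) (by linarith [h.pos_right]) (a - 1) hx.1.le hx.2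
  constructor
  · rw [← IntervalIntegrable.comp_mul_left_iff hx.1.ne', zero_div, div_self hx.1.ne',
      intervalIntegrable_iff_integrableOn_Ioo_of_le zero_le_one]
    refine IntegrableOn.congr_fun (hi.const_mul (x ^ (-a))) (fun v hv => ?_) measurableSet_Ioo
    exact (jacobiWeight_mul_rpow_scaled hx hv).symm
  · have e := intervalIntegral.smul_integral_comp_mul_left (a := 0) (b := 1)
      (fun s => jacobiWeight (a - 1) (b - 1) s * (x - s) ^ (1 - a - b)) x
    rw [mul_zero, mul_one] at e
    rw [← e, intervalIntegral.integral_of_le zero_le_one, integral_Ioc_eq_integral_Ioo,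
      setIntegral_congr_fun measurableSet_Ioo (fun v hv => jacobiWeight_mul_rpow_scaled hx hv),
      integral_const_mul, smul_eq_mul, ← mul_assoc, mul_comm x, ← Real.rpow_add_one hx.1.ne',
      neg_add_eq_sub, eulerInt]

theorem Admissible.right_integral {a b x : ℝ} (h : Admissible a b) (hx : x ∈ Ioo (0 : ℝ) 1) :
    IntervalIntegrable (fun s => jacobiWeight (a - 1) (b - 1) s * (s - x) ^ (1 - a - b)) volume x 1 ∧
    ∫ s in x..(1 : ℝ), jacobiWeight (a - 1) (b - 1) s * (s - x) ^ (1 - a - b) =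
      (1 - x) ^ (1 - b) * eulerInt b a (1 - x) := by
  have hx' : 1 - x ∈ Ioo (0 : ℝ) 1 := ⟨by linarith [hx.2], by linarith [hx.1]⟩
  obtain ⟨h1, h2⟩ := h.symm.left_integral hx'
  have e : (fun s => jacobiWeight (b - 1) (a - 1) (1 - s) * (1 - x - (1 - s)) ^ (1 - b - a)) =
      fun s => jacobiWeight (a - 1) (b - 1) s * (s - x) ^ (1 - a - b) := by
    ext s
    rw [jacobiWeight_one_sub, show 1 - x - (1 - s) = s - x by ring,
      show 1 - b - a = 1 - a - b by ring]
  constructor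
  · have := (h1.comp_sub_left 1).symm
    rwa [sub_zero, sub_sub_cancel, e] at this
  · rw [← h2, ← e, intervalIntegral.integral_comp_sub_left (fun s => jacobiWeight (b - 1) (a - 1) s *
      (1 - x - s) ^ (1 - b - a)) 1]
    simp

theorem Admissible.integral_weight_kern {a b x : ℝ} (h : Admissible a b) (hx : x ∈ Ioo (0 : ℝ) 1) :
    IntegrableOn (fun s => jacobiWeight (a - 1) (b - 1) s * kern a b (x - s)) (Ioo (0 : ℝ) 1) ∧
    ∫ s in Ioo (0 : ℝ) 1, jacobiWeight (a - 1) (b - 1) s * kern a b (x - s) =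
      Real.pi / (Real.sin (Real.pi * a) + Real.sin (Real.pi * b)) := by
  obtain ⟨h1, h2⟩ := integral_mul_kern hx (h.left_integral hx).1 (h.right_integral hx).1
  refine ⟨h1, ?_⟩
  have h3 := sin_mul_eulerInt_add h.pos_left h.left_le h.pos_right h.right_le h.lt_two hx
  have h4 := h.sin_add_sin_pos
  rw [h2, (h.left_integral hx).2, (h.right_integral hx).2, skewness, skewness,
    add_comm (Real.sin (Real.pi * b)), eq_div_iff h4.ne']
  field_simp
  linear_combination h3

/-- The two-sided integral operator applied to a multiple of the weight `ω^{(a-1,b-1)}`. -/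
def abelOp (a b : ℝ) (p : ℝ → ℝ) (x : ℝ) : ℝ :=
  ∫ s in Ioo (0 : ℝ) 1, jacobiWeight (a - 1) (b - 1) s * p s * kern a b (x - s)

theorem Admissible.integrableOn_abelOp {a b x : ℝ} (h : Admissible a b) (hx : x ∈ Ioo (0 : ℝ) 1)
    {p : ℝ → ℝ} (hp : Continuous p) :
    IntegrableOn (fun s => jacobiWeight (a - 1) (b - 1) s * p s * kern a b (x - s))
      (Ioo (0 : ℝ) 1) := by
  refine (integrableOn_mul_of_continuousOn_Icc (h.integral_weight_kern hx).1
    hp.continuousOn).congr (Eventually.of_forall fun s => ?_)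
  simp only; ring

/-- The weight and the kernel are nonnegative and their inner integral is a constant, so
integrability of φ alone justifies Fubini; p is bounded on [0,1]. -/
theorem Admissible.integrable_prod {a b : ℝ} (h : Admissible a b) {φ p : ℝ → ℝ}
    (hφ : IntegrableOn φ (Ioo (0 : ℝ) 1)) (hp : Continuous p) :
    Integrable (fun z : ℝ × ℝ => φ z.1 * (jacobiWeight (a - 1) (b - 1) z.2 * p z.2 *
      kern a b (z.1 - z.2))) ((volume.restrict (Ioo 0 1)).prod (volume.restrict (Ioo 0 1))) := by
  have hk : Measurable fun z : ℝ × ℝ => jacobiWeight (a - 1) (b - 1) z.2 * kern a b (z.1 - z.2) :=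
    ((measurable_jacobiWeight _ _).comp measurable_snd).mul
      ((measurable_kern a b).comp (measurable_fst.sub measurable_snd))
  have h1 : Integrable (fun z : ℝ × ℝ => φ z.1 * (jacobiWeight (a - 1) (b - 1) z.2 *
      kern a b (z.1 - z.2))) ((volume.restrict (Ioo 0 1)).prod (volume.restrict (Ioo 0 1))) := by
    have hm : AEStronglyMeasurable (fun z : ℝ × ℝ => φ z.1 * (jacobiWeight (a - 1) (b - 1) z.2 *
        kern a b (z.1 - z.2))) ((volume.restrict (Ioo 0 1)).prod (volume.restrict (Ioo 0 1))) :=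
      hφ.1.comp_fst.mul hk.aestronglyMeasurable
    rw [integrable_prod_iff hm]
    constructor
    · filter_upwards [ae_restrict_mem measurableSet_Ioo] with y hy
      exact (h.integral_weight_kern hy).1.const_mul _
    · refine (hφ.norm.mul_const (Real.pi / (Real.sin (Real.pi * a) + Real.sin (Real.pi * b)))).congr ?_
      filter_upwards [ae_restrict_mem measurableSet_Ioo] with y hy
      rw [← (h.integral_weight_kern hy).2, ← integral_const_mul]
      refine setIntegral_congr_fun measurableSet_Ioo fun s hs => ?_
      simp only [norm_mul, Real.norm_of_nonneg (jacobiWeight_pos (a - 1) (b - 1) hs).le,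
        Real.norm_of_nonneg (h.kern_nonneg _)]
  obtain ⟨c, hc⟩ := isCompact_Icc.exists_bound_of_continuousOn (s := Icc (0 : ℝ) 1) hp.continuousOn
  refine (h1.mul_bdd (c := c) (g := fun z : ℝ × ℝ => p z.2)
    (hp.comp continuous_snd).aestronglyMeasurable ?_).congr (Eventually.of_forall fun z => ?_)
  · rw [Measure.prod_restrict]
    filter_upwards [ae_restrict_mem (measurableSet_Ioo.prod measurableSet_Ioo)] with z hz
    exact hc _ (Ioo_subset_Icc_self hz.2)
  · simp only; ring

theorem Admissible.integral_mul_abelOp {a b : ℝ} (h : Admissible a b) {φ p : ℝ → ℝ}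
    (hφ : IntegrableOn φ (Ioo (0 : ℝ) 1)) (hp : Continuous p) :
    ∫ y in Ioo (0 : ℝ) 1, φ y * abelOp a b p y =
      ∫ s in Ioo (0 : ℝ) 1, jacobiWeight (a - 1) (b - 1) s * p s *
        ∫ y in Ioo (0 : ℝ) 1, φ y * kern a b (y - s) := by
  have := integral_integral_swap (f := fun y s => φ y * (jacobiWeight (a - 1) (b - 1) s * p s *
      kern a b (y - s))) (h.integrable_prod hφ hp)
  simp only [abelOp, ← integral_const_mul]
  rw [this]
  congr 1; ext s; congr 1; ext y
  ring

/-- `z ↦ z · kern z`, an antiderivative of `(2 - a - b) kern`. -/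
def kernInt (a b z : ℝ) : ℝ :=
  skewness a b * (max z 0) ^ (2 - a - b) - skewness b a * (max (-z) 0) ^ (2 - a - b)

theorem Admissible.continuous_kernInt {a b : ℝ} (h : Admissible a b) : Continuous (kernInt a b) := by
  have := h.lt_two
  unfold kernInt
  exact (continuous_const.mul ((continuous_id.max continuous_const).rpow_const
    fun _ => Or.inr (by linarith))).sub (continuous_const.mul
    ((continuous_id.neg.max continuous_const).rpow_const fun _ => Or.inr (by linarith)))

theorem Admissible.kernInt_eq {a b : ℝ} (h : Admissible a b) (z : ℝ) :
    kernInt a b z = z * kern a b z := by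
  have h2 : 2 - a - b ≠ 0 := by linarith [h.lt_two]
  rcases lt_trichotomy z 0 with hz | rfl | hz
  · rw [kern_of_neg a b hz, kernInt, max_eq_right hz.le, max_eq_left (by linarith),
      Real.zero_rpow h2, show 2 - a - b = 1 - a - b + 1 by ring, Real.rpow_add_one (by linarith)]
    ring
  · simp [kernInt, Real.zero_rpow h2]
  · rw [kern_of_pos a b hz, kernInt, max_eq_left hz.le, max_eq_right (by linarith),
      Real.zero_rpow h2, show 2 - a - b = 1 - a - b + 1 by ring, Real.rpow_add_one (by linarith)]
    ring

theorem Admissible.hasDerivAt_kernInt {a b : ℝ} (h : Admissible a b) {z : ℝ} (hz : z ≠ 0) :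
    HasDerivAt (kernInt a b) ((2 - a - b) * kern a b z) z := by
  have h2 : 2 - a - b ≠ 0 := by linarith [h.lt_two]
  rcases lt_or_gt_of_ne hz with hz | hz
  · have h1 : HasDerivAt (fun z : ℝ => -skewness b a * (-z) ^ (2 - a - b))
        ((2 - a - b) * kern a b z) z := by
      refine (((hasDerivAt_id z).neg.rpow_const (p := 2 - a - b)
        (Or.inl (by simpa using hz.ne))).const_mul _).congr_deriv ?_
      rw [kern_of_neg a b hz, show 2 - a - b - 1 = 1 - a - b by ring]
      simp; ring
    refine h1.congr_of_eventuallyEq ?_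
    filter_upwards [Iio_mem_nhds hz] with y hy
    rw [kernInt, max_eq_right (le_of_lt hy), max_eq_left (by linarith [mem_Iio.1 hy]), Real.zero_rpow h2]
    ring
  · have h1 : HasDerivAt (fun z : ℝ => skewness a b * z ^ (2 - a - b))
        ((2 - a - b) * kern a b z) z := by
      refine (((hasDerivAt_id z).rpow_const (p := 2 - a - b)
        (Or.inl hz.ne')).const_mul _).congr_deriv ?_
      rw [kern_of_pos a b hz, show 2 - a - b - 1 = 1 - a - b by ring]
      simp; ring
    refine h1.congr_of_eventuallyEq ?_
    filter_upwards [Ioi_mem_nhds hz] with y hy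
    rw [kernInt, max_eq_left (le_of_lt hy), max_eq_right (by linarith [mem_Ioi.1 hy]), Real.zero_rpow h2]
    ring

theorem Admissible.intervalIntegrable_kern {a b : ℝ} (h : Admissible a b) (c d : ℝ) :
    IntervalIntegrable (kern a b) volume c d := by
  have h2 : -1 < 1 - a - b := by linarith [h.lt_two]
  have h1 : ∀ c d : ℝ, IntervalIntegrable (fun z : ℝ => if 0 < z then z ^ (1 - a - b) else 0)
      volume c d := by
    intro c d
    have := intervalIntegral.intervalIntegrable_rpow' (a := c) (b := d) h2
    rw [intervalIntegrable_iff] at this ⊢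
    exact this.indicator (measurableSet_Ioi (a := (0 : ℝ)))
  have h3 : IntervalIntegrable (fun z : ℝ => if z < 0 then (-z) ^ (1 - a - b) else 0)
      volume c d := by
    have := (h1 (-c) (-d)).comp_sub_left 0
    simpa using this
  exact ((h1 c d).const_mul _).add (h3.const_mul _)

/-- The singularity at 0 is a single point, and the antiderivative is continuous across it. -/
theorem Admissible.integral_kern {a b : ℝ} (h : Admissible a b) (x s : ℝ) :
    (2 - a - b) * ∫ y in (0 : ℝ)..x, kern a b (y - s) = kernInt a b (x - s) - kernInt a b (-s) := by
  rw [intervalIntegral.integral_comp_sub_right (kern a b) s, ← intervalIntegral.integral_const_mul,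
    integral_eq_of_hasDerivAt_off_countable (kernInt a b) _ (countable_singleton (0 : ℝ))
      h.continuous_kernInt.continuousOn (fun z hz => h.hasDerivAt_kernInt hz.2)
      ((h.intervalIntegrable_kern _ _).const_mul _), zero_sub]

/-- Write s = x - (x - s). The factor (x - s) kern(x - s) is a primitive of (2-a-b) kern, so by
Fubini its contribution is the integral of `abelOp a b p` from 0 to x, up to a constant. -/
theorem Admissible.abelOp_mul_id {a b x : ℝ} (h : Admissible a b) (hx : x ∈ Ioo (0 : ℝ) 1)
    {p : ℝ → ℝ} (hp : Continuous p) :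
    abelOp a b (fun s => s * p s) x = x * abelOp a b p x -
      (2 - a - b) * (∫ y in (0 : ℝ)..x, abelOp a b p y) -
      ∫ s in Ioo (0 : ℝ) 1, jacobiWeight (a - 1) (b - 1) s * p s * kernInt a b (-s) := by
  have hw := integrableOn_jacobiWeight (a := a - 1) (b := b - 1) (by linarith [h.pos_left])
    (by linarith [h.pos_right])
  -- Pairing with the indicator of (0,x) turns the transposition formula into one for the primitive.
  have hF := h.integral_mul_abelOp (φ := (Ioo 0 x).indicator fun _ => 1) (p := p)
    (Integrable.indicator (integrable_const (1 : ℝ)) measurableSet_Ioo) hp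
  have hind : ∀ g : ℝ → ℝ, ∫ y in Ioo (0 : ℝ) 1, (Ioo 0 x).indicator (fun _ => (1 : ℝ)) y * g y =
      ∫ y in (0 : ℝ)..x, g y := by
    intro g
    have e : (fun y => (Ioo 0 x).indicator (fun _ => (1 : ℝ)) y * g y) = (Ioo 0 x).indicator g := by
      ext y; by_cases hy : y ∈ Ioo 0 x <;> simp [hy]
    rw [e, integral_indicator measurableSet_Ioo, Measure.restrict_restrict measurableSet_Ioo,
      inter_eq_self_of_subset_left (Ioo_subset_Ioo_right hx.2.le),
      intervalIntegral.integral_of_le hx.1.le, integral_Ioc_eq_integral_Ioo]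
  simp only [hind] at hF
  have hwk : ∀ k : ℝ → ℝ, Continuous k →
      IntegrableOn (fun s => jacobiWeight (a - 1) (b - 1) s * p s * k s) (Ioo (0 : ℝ) 1) :=
    fun k hk => integrableOn_mul_of_continuousOn_Icc (integrableOn_mul_of_continuousOn_Icc hw
      hp.continuousOn) hk.continuousOn
  have hK := h.continuous_kernInt
  have h1 : (2 - a - b) * ∫ y in (0 : ℝ)..x, abelOp a b p y =
      (∫ s in Ioo (0 : ℝ) 1, jacobiWeight (a - 1) (b - 1) s * p s * kernInt a b (x - s)) -
      ∫ s in Ioo (0 : ℝ) 1, jacobiWeight (a - 1) (b - 1) s * p s * kernInt a b (-s) := by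
    rw [hF, ← integral_const_mul, ← integral_sub (hwk _ (by fun_prop)) (hwk _ (by fun_prop))]
    congr 1; ext s
    linear_combination (jacobiWeight (a - 1) (b - 1) s * p s) * h.integral_kern x s
  have h2 : x * abelOp a b p x - abelOp a b (fun s => s * p s) x =
      ∫ s in Ioo (0 : ℝ) 1, jacobiWeight (a - 1) (b - 1) s * p s * kernInt a b (x - s) := by
    unfold abelOp
    rw [← integral_const_mul, ← integral_sub ((h.integrableOn_abelOp hx hp).const_mul _)
      (h.integrableOn_abelOp hx (p := fun s => s * p s) (by fun_prop))]
    congr 1; ext s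
    rw [h.kernInt_eq]
    ring
  linarith

theorem exists_antiderivative (Q : ℝ[X]) : ∃ R : ℝ[X], derivative R = Q := by
  refine ⟨∑ i ∈ Finset.range (Q.natDegree + 1), C (Q.coeff i / (i + 1)) * X ^ (i + 1), ?_⟩
  rw [derivative_sum]
  conv_rhs => rw [Q.as_sum_range_C_mul_X_pow]
  refine Finset.sum_congr rfl fun i _ => ?_
  rw [derivative_C_mul_X_pow, Nat.add_sub_cancel]
  congr 2
  push_cast
  have : (i : ℝ) + 1 ≠ 0 := by positivity
  field_simp

/-- The factor by which the two-sided operator multiplies the leading coefficient. -/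
def abelFactor (a b : ℝ) (n : ℕ) : ℝ :=
  Real.pi / (Real.sin (Real.pi * a) + Real.sin (Real.pi * b)) *
    (Real.Gamma (n + (a + b) - 1) / (Real.Gamma (a + b - 1) * n.factorial))

theorem Admissible.abelFactor_zero {a b : ℝ} (h : Admissible a b) :
    abelFactor a b 0 = Real.pi / (Real.sin (Real.pi * a) + Real.sin (Real.pi * b)) := by
  have := Real.Gamma_pos_of_pos (show 0 < a + b - 1 by linarith [h.one_lt])
  simp [abelFactor, this.ne']

theorem Admissible.abelFactor_succ {a b : ℝ} (h : Admissible a b) (n : ℕ) :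
    abelFactor a b (n + 1) = abelFactor a b n * (1 - (2 - a - b) / (n + 1)) := by
  have h0 : (0 : ℝ) ≤ n := Nat.cast_nonneg n
  have e : Real.Gamma (((n + 1 : ℕ) : ℝ) + (a + b) - 1) =
      (n + (a + b) - 1) * Real.Gamma (n + (a + b) - 1) := by
    rw [← Real.Gamma_add_one (by linarith [h.one_lt])]
    congr 1; push_cast; ring
  have g1 := Real.Gamma_pos_of_pos (show 0 < a + b - 1 by linarith [h.one_lt])
  have g2 := h.sin_add_sin_pos
  unfold abelFactor
  rw [e, Nat.factorial_succ]
  push_cast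
  field_simp
  ring

/-- Induction through p = X · `p.divX` + constant. Multiplication by X shifts the leading
coefficient and the primitive divides it by n + 1, whence the factor 1 - (2-a-b)/(n+1) relating
consecutive values of `abelFactor`. -/
theorem Admissible.abelOp_polynomial {a b : ℝ} (h : Admissible a b) (n : ℕ) :
    ∀ p : ℝ[X], p.natDegree ≤ n → ∃ Q : ℝ[X], Q.natDegree ≤ n ∧
      Q.coeff n = abelFactor a b n * p.coeff n ∧
      ∀ x ∈ Ioo (0 : ℝ) 1, abelOp a b (fun s => p.eval s) x = Q.eval x := by
  have hconst : ∀ c : ℝ, ∀ x ∈ Ioo (0 : ℝ) 1, abelOp a b (fun _ => c) x = c * abelFactor a b 0 := by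
    intro c x hx
    rw [h.abelFactor_zero, ← (h.integral_weight_kern hx).2, ← integral_const_mul, abelOp]
    congr 1; ext s; ring
  induction n with
  | zero =>
    intro p hp
    obtain ⟨c, rfl⟩ : ∃ c, p = C c := ⟨_, eq_C_of_natDegree_le_zero hp⟩
    refine ⟨C (c * abelFactor a b 0), (natDegree_C _).le, by simp [mul_comm], fun x hx => ?_⟩
    simp only [eval_C]
    exact hconst c x hx
  | succ n ih =>
    intro p hp
    obtain ⟨Q, hQd, hQc, hQ⟩ := ih p.divX (by rw [natDegree_divX_eq_natDegree_tsub_one]; omega)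
    obtain ⟨R, hR⟩ := exists_antiderivative Q
    have hRc : ∀ m, R.coeff (m + 1) = Q.coeff m / (m + 1) := by
      intro m
      rw [← hR, coeff_derivative]
      have : (m : ℝ) + 1 ≠ 0 := by positivity
      field_simp
    set D := ∫ s in Ioo (0 : ℝ) 1, jacobiWeight (a - 1) (b - 1) s * p.divX.eval s * kernInt a b (-s)
    refine ⟨X * Q - C (2 - a - b) * R + C ((2 - a - b) * R.eval 0 - D +
      p.coeff 0 * abelFactor a b 0), ?_, ?_, ?_⟩
    · rw [natDegree_le_iff_coeff_eq_zero] at hQd ⊢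
      intro m hm
      obtain ⟨k, rfl⟩ : ∃ k, m = k + 1 := ⟨m - 1, by omega⟩
      simp only [coeff_add, coeff_sub, coeff_X_mul, coeff_C_mul, hRc, coeff_C_succ, hQd k (by omega)]
      ring
    · have : (n : ℝ) + 1 ≠ 0 := by positivity
      simp only [coeff_add, coeff_sub, coeff_X_mul, coeff_C_mul, hRc, coeff_C_succ, hQc,
        h.abelFactor_succ, coeff_divX]
      ring
    · intro x hx
      have e : ∀ y, p.eval y = y * p.divX.eval y + p.coeff 0 := by
        intro y
        conv_lhs => rw [← divX_mul_X_add p]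
        simp; ring
      have h1 : abelOp a b (fun s => p.eval s) x =
          abelOp a b (fun s => s * p.divX.eval s) x + abelOp a b (fun _ => p.coeff 0) x := by
        unfold abelOp
        rw [← integral_add (h.integrableOn_abelOp hx (p := fun s => s * p.divX.eval s)
          (continuous_id.mul p.divX.continuous)) (h.integrableOn_abelOp hx continuous_const)]
        congr 1; ext s
        simp only [e s]; ring
      have h2 : ∫ y in (0 : ℝ)..x, abelOp a b (fun s => p.divX.eval s) y = R.eval x - R.eval 0 := by
        rw [intervalIntegral.integral_congr_Ioo_of_le (g := fun y => (derivative R).eval y) hx.1.le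
          (fun y hy => by rw [hR]; exact hQ y ⟨hy.1, hy.2.trans hx.2⟩)]
        exact intervalIntegral.integral_eq_sub_of_hasDerivAt (fun y _ => R.hasDerivAt y)
          ((derivative R).continuous.intervalIntegrable _ _)
      rw [h1, hconst _ x hx, h.abelOp_mul_id hx p.divX.continuous, h2, hQ x hx]
      simp [D]
      ring

/-- The two-sided operator maps `ω^{(a-1,b-1)} G_n^{(a-1,b-1)}` to a multiple of `G_n^{(b-1,a-1)}`. -/
theorem Admissible.abelOp_jacobiPoly {a b x : ℝ} (h : Admissible a b) (n : ℕ)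
    (hx : x ∈ Ioo (0 : ℝ) 1) :
    abelOp a b (fun s => (jacobiPoly n (a - 1) (b - 1)).eval s) x =
      abelFactor a b n * (jacobiPoly n (b - 1) (a - 1)).eval x := by
  have ha : -1 < a - 1 := by linarith [h.pos_left]
  have hb : -1 < b - 1 := by linarith [h.pos_right]
  obtain ⟨Q, hQd, hQc, hQ⟩ := h.abelOp_polynomial n _ (natDegree_jacobiPoly_le n (a - 1) (b - 1))
  -- Transposition moves the operator, with a and b exchanged, onto q. Its image still has degree
  -- below n, so the Jacobi polynomial is orthogonal to it.
  have horth : ∀ q : ℝ[X], q.degree < n → jacobiMoment (b - 1) (a - 1) (q * Q) = 0 := by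
    intro q hq
    rcases Nat.eq_zero_or_pos n with rfl | hn
    · have : q = 0 := by
        rw [degree_lt_iff_coeff_zero] at hq
        ext m; simpa using hq m (Nat.zero_le m)
      simp [this, jacobiMoment]
    · have hqn : q.natDegree ≤ n - 1 := by
        rw [degree_lt_iff_coeff_zero] at hq
        rw [natDegree_le_iff_coeff_eq_zero]
        exact fun m hm => hq m (by omega)
      obtain ⟨Q', hQd', -, hQ'⟩ := h.symm.abelOp_polynomial (n - 1) q hqn
      have hF := h.integral_mul_abelOp (φ := fun y => jacobiWeight (b - 1) (a - 1) y * q.eval y)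
        (integrableOn_jacobiWeight_mul_eval hb ha q) (jacobiPoly n (a - 1) (b - 1)).continuous
      have e1 : jacobiMoment (b - 1) (a - 1) (q * Q) = ∫ y in Ioo (0 : ℝ) 1,
          jacobiWeight (b - 1) (a - 1) y * q.eval y *
            abelOp a b (fun s => (jacobiPoly n (a - 1) (b - 1)).eval s) y := by
        refine setIntegral_congr_fun measurableSet_Ioo fun y hy => ?_
        simp only [hQ y hy, eval_mul]; ring
      have e2 : ∫ s in Ioo (0 : ℝ) 1, jacobiWeight (a - 1) (b - 1) s *
          (jacobiPoly n (a - 1) (b - 1)).eval s * ∫ y in Ioo (0 : ℝ) 1,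
            jacobiWeight (b - 1) (a - 1) y * q.eval y * kern a b (y - s) =
          jacobiMoment (a - 1) (b - 1) (Q' * jacobiPoly n (a - 1) (b - 1)) := by
        refine setIntegral_congr_fun measurableSet_Ioo fun s hs => ?_
        have e3 := hQ' s hs
        rw [abelOp] at e3
        have e4 : ∀ y, kern a b (y - s) = kern b a (s - y) := fun y => by
          rw [← kern_neg b a, neg_sub]
        simp only [e4, e3, eval_mul]; ring
      rw [e1, hF, e2]
      refine jacobiMoment_mul_jacobiPoly_eq_zero n ha hb _ ?_
      rw [degree_lt_iff_coeff_zero]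
      rw [natDegree_le_iff_coeff_eq_zero] at hQd'
      exact fun m hm => hQd' m (by omega)
  -- The leading terms cancel, so E has degree below n. Both of its parts are orthogonal to such
  -- polynomials, in particular to E itself.
  set E := Q + C (-abelFactor a b n) * jacobiPoly n (b - 1) (a - 1) with hE
  have hEdeg : E.degree < n := by
    rw [degree_lt_iff_coeff_zero]
    intro m hm
    rw [hE, coeff_add, coeff_C_mul]
    rcases hm.eq_or_lt with rfl | hm
    · rw [hQc, coeff_jacobiPoly_swap]; ring
    · rw [coeff_eq_zero_of_natDegree_lt (hQd.trans_lt hm),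
        coeff_eq_zero_of_natDegree_lt ((natDegree_jacobiPoly_le n _ _).trans_lt hm)]
      simp
  have hE0 : E = 0 := by
    by_contra hne
    have h1 := jacobiMoment_sq_pos hb ha hne
    have h2 : E * E = E * Q + C (-abelFactor a b n) * (E * jacobiPoly n (b - 1) (a - 1)) := by
      nth_rewrite 2 [hE]; ring
    rw [h2, jacobiMoment_add hb ha, jacobiMoment_C_mul, horth E hEdeg,
      jacobiMoment_mul_jacobiPoly_eq_zero n hb ha E hEdeg] at h1
    simp at h1
  rw [hQ x hx]
  have := congrArg (fun p => p.eval x) hE0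
  simp [hE] at this
  linarith

end Kernel

/-! ### The fractional operator on weighted Jacobi polynomials, and its weak form. -/

section Operator

theorem Admissible.twoSidedFracInt_eq {α a b x : ℝ} (h : Admissible a b) (hα : α = a + b)
    {w : ℝ → ℝ} (hx : x ∈ Ioo (0 : ℝ) 1)
    (hl : IntervalIntegrable (fun s => w s * (x - s) ^ (1 - a - b)) volume 0 x)
    (hr : IntervalIntegrable (fun s => w s * (s - x) ^ (1 - a - b)) volume x 1) :
    twoSidedFracInt α (skewness a b) w x =
      1 / Real.Gamma (2 - α) * ∫ s in Ioo (0 : ℝ) 1, w s * kern a b (x - s) := by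
  rw [(integral_mul_kern hx hl hr).2, twoSidedFracInt, leftFracInt, rightFracInt,
    h.one_sub_skewness, show 2 - α - 1 = 1 - a - b by rw [hα]; ring]
  ring

theorem twoSidedFracInt_congr {α r x : ℝ} {w w' : ℝ → ℝ} (hx : x ∈ Ioo (0 : ℝ) 1)
    (hw : EqOn w w' (Ioo 0 1)) : twoSidedFracInt α r w x = twoSidedFracInt α r w' x := by
  unfold twoSidedFracInt leftFracInt rightFracInt
  rw [intervalIntegral.integral_congr_Ioo_of_le hx.1.le
      (fun s hs => by rw [hw ⟨hs.1, hs.2.trans hx.2⟩]),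
    intervalIntegral.integral_congr_Ioo_of_le hx.2.le
      (fun s hs => by rw [hw ⟨hx.1.trans hs.1, hs.2⟩])]

theorem Admissible.twoSidedFracInt_weight_mul {α a b x : ℝ} (h : Admissible a b) (hα : α = a + b)
    (hx : x ∈ Ioo (0 : ℝ) 1) {p : ℝ → ℝ} (hp : Continuous p) :
    twoSidedFracInt α (skewness a b) (fun s => jacobiWeight (a - 1) (b - 1) s * p s) x =
      1 / Real.Gamma (2 - α) * abelOp a b p x := by
  refine h.twoSidedFracInt_eq hα hx ?_ ?_
  · refine ((h.left_integral hx).1.mul_continuousOn hp.continuousOn).congr fun s _ => ?_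
    ring
  · refine ((h.right_integral hx).1.mul_continuousOn hp.continuousOn).congr fun s _ => ?_
    ring

/-- The polynomial `q` with `D (ω^{(a,b)} p) = ω^{(a-1,b-1)} q`. -/
def weightedDeriv (a b : ℝ) (p : ℝ[X]) : ℝ[X] :=
  (C b * (1 - X) - C a * X) * p + X * (1 - X) * derivative p

theorem hasDerivAt_weighted (a b : ℝ) (p : ℝ[X]) {x : ℝ} (hx : x ∈ Ioo (0 : ℝ) 1) :
    HasDerivAt (fun x => jacobiWeight a b x * p.eval x)
      (jacobiWeight (a - 1) (b - 1) x * (weightedDeriv a b p).eval x) x := by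
  have := hasDerivAt_jacobiWeight_mul_eval (a - 1) (b - 1) p hx
  simpa only [sub_add_cancel, weightedDeriv] using this

theorem weightedDeriv_jacobiPoly (n : ℕ) (a b : ℝ) :
    weightedDeriv a b (jacobiPoly n a b) =
      C (-((n : ℝ) + 1)) * jacobiPoly (n + 1) (a - 1) (b - 1) := by
  have := rodrigues_step n (a - 1) (b - 1)
  rw [sub_add_cancel, sub_add_cancel] at this
  rw [weightedDeriv, this, C_neg]

theorem weightedDeriv_sum (a b : ℝ) (N : ℕ) (c : ℕ → ℝ) (p : ℕ → ℝ[X]) :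
    weightedDeriv a b (∑ j ∈ Finset.range N, C (c j) * p j) =
      ∑ j ∈ Finset.range N, C (c j) * weightedDeriv a b (p j) := by
  unfold weightedDeriv
  rw [derivative_sum, Finset.mul_sum, Finset.mul_sum, ← Finset.sum_add_distrib]
  refine Finset.sum_congr rfl fun j _ => ?_
  rw [derivative_C_mul]
  ring

theorem Admissible.opL_weighted {α a b x : ℝ} (h : Admissible a b) (hα : α = a + b)
    (hx : x ∈ Ioo (0 : ℝ) 1) (p : ℝ[X]) :
    opL α (skewness a b) (fun x => jacobiWeight a b x * p.eval x) x =
      -(1 / Real.Gamma (2 - α) * abelOp a b (fun s => (weightedDeriv a b p).eval s) x) := by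
  rw [opL, twoSidedFracInt_congr hx (fun s hs => (hasDerivAt_weighted a b p hs).deriv),
    h.twoSidedFracInt_weight_mul hα hx (weightedDeriv a b p).continuous]

/-- The reflection formula Γ(α-1)Γ(2-α) = π/sin(π(α-1)) trades the gamma factors for a sine; the
minus sign is sin(π(α-1)) = -sin(πα). -/
theorem Admissible.eigenvalue_eq {α a b : ℝ} (h : Admissible a b) (hα : α = a + b) (j : ℕ) :
    1 / Real.Gamma (2 - α) * (((j : ℝ) + 1) * abelFactor a b (j + 1)) = -eigenvalue α b j := by
  have h1 := Real.Gamma_mul_Gamma_one_sub (α - 1)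
  have h2 : Real.sin (Real.pi * (α - 1)) = -Real.sin (Real.pi * α) := by
    rw [mul_sub, mul_one, Real.sin_sub_pi]
  have hs : 0 < Real.sin (Real.pi * (α - 1)) :=
    sin_pi_mul_pos (by linarith [h.one_lt]) (by linarith [h.lt_two])
  have g1 := Real.Gamma_pos_of_pos (show 0 < a + b - 1 by linarith [h.one_lt])
  have g2 := Real.Gamma_pos_of_pos (show 0 < 2 - α by linarith [h.lt_two])
  have g3 := h.sin_add_sin_pos
  rw [h2, show 1 - (α - 1) = 2 - α by ring, eq_div_iff (by rw [← h2]; exact hs.ne'), hα] at h1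
  unfold eigenvalue abelFactor
  rw [Nat.factorial_succ, hα, add_sub_cancel_right,
    show ((j + 1 : ℕ) : ℝ) + (a + b) - 1 = j + (a + b) by push_cast; ring]
  rw [hα] at g2
  push_cast
  generalize Real.sin (Real.pi * (a + b)) = S at h1 ⊢
  generalize Real.sin (Real.pi * a) + Real.sin (Real.pi * b) = S' at g3 ⊢
  generalize Real.Gamma (a + b - 1) = Γ₁ at h1 g1 ⊢
  generalize Real.Gamma (2 - (a + b)) = Γ₂ at h1 g2 ⊢
  field_simp
  linear_combination -Real.Gamma (j + (a + b)) * h1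

/-- The operator on the weighted Jacobi polynomials. -/
theorem Admissible.opL_sum {α a b x : ℝ} (h : Admissible a b) (hα : α = a + b)
    (hx : x ∈ Ioo (0 : ℝ) 1) (N : ℕ) (c : ℕ → ℝ) :
    opL α (skewness a b) (fun x => jacobiWeight a b x *
        (∑ j ∈ Finset.range N, C (c j) * jacobiPoly j a b).eval x) x =
      ∑ j ∈ Finset.range N, -(c j * eigenvalue α b j) * jacobiG (j + 1) (b - 1) (a - 1) x := by
  rw [h.opL_weighted hα hx, weightedDeriv_sum]
  have h1 : abelOp a b (fun s => (∑ j ∈ Finset.range N,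
      C (c j) * weightedDeriv a b (jacobiPoly j a b)).eval s) x =
      ∑ j ∈ Finset.range N, (c j * -((j : ℝ) + 1)) *
        abelOp a b (fun s => (jacobiPoly (j + 1) (a - 1) (b - 1)).eval s) x := by
    unfold abelOp
    simp only [← integral_const_mul]
    rw [← integral_finsetSum _ fun j _ => (h.integrableOn_abelOp hx
      (jacobiPoly (j + 1) (a - 1) (b - 1)).continuous).const_mul _]
    congr 1; ext s
    rw [eval_finsetSum, Finset.mul_sum, Finset.sum_mul]
    refine Finset.sum_congr rfl fun j _ => ?_
    rw [weightedDeriv_jacobiPoly, eval_mul, eval_mul, eval_C, eval_C]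
    ring
  rw [h1, Finset.mul_sum, ← Finset.sum_neg_distrib]
  refine Finset.sum_congr rfl fun j _ => ?_
  rw [h.abelOp_jacobiPoly (j + 1) hx, eval_jacobiPoly]
  linear_combination (c j * jacobiG (j + 1) (b - 1) (a - 1) x) * h.eigenvalue_eq hα j

theorem absolutelyContinuousOnInterval_congr {f g : ℝ → ℝ} {a b : ℝ}
    (hf : AbsolutelyContinuousOnInterval f a b) (hfg : EqOn f g (uIcc a b)) :
    AbsolutelyContinuousOnInterval g a b := by
  rw [absolutelyContinuousOnInterval_iff] at hf ⊢
  intro ε hε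
  obtain ⟨δ, hδ, h⟩ := hf ε hε
  refine ⟨δ, hδ, fun E hE hEδ => ?_⟩
  rw [Finset.sum_congr rfl fun i hi => by
    rw [← hfg (hE.1 i hi).1, ← hfg (hE.1 i hi).2]]
  exact h E hE hEδ

theorem Admissible.intervalIntegrable_weightedDeriv {a b : ℝ} (h : Admissible a b) (p : ℝ[X]) :
    IntervalIntegrable (fun x => jacobiWeight (a - 1) (b - 1) x * (weightedDeriv a b p).eval x)
      volume 0 1 :=
  (intervalIntegrable_iff_integrableOn_Ioo_of_le zero_le_one).2
    (integrableOn_jacobiWeight_mul_eval (by linarith [h.pos_left]) (by linarith [h.pos_right]) _)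

theorem Admissible.weighted_zero {a b : ℝ} (h : Admissible a b) : jacobiWeight a b 0 = 0 := by
  simp [jacobiWeight, Real.zero_rpow h.pos_right.ne']

theorem Admissible.weighted_one {a b : ℝ} (h : Admissible a b) : jacobiWeight a b 1 = 0 := by
  simp [jacobiWeight, Real.zero_rpow h.pos_left.ne']

theorem Admissible.continuous_weighted {a b : ℝ} (h : Admissible a b) (p : ℝ[X]) :
    Continuous (fun x => jacobiWeight a b x * p.eval x) :=
  (continuous_jacobiWeight h.pos_left.le h.pos_right.le).mul p.continuous

/-- The derivative may blow up at the endpoints but is integrable, since a - 1 and b - 1 exceed -1;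
the function is its primitive. -/
theorem Admissible.absolutelyContinuous_weighted {a b : ℝ} (h : Admissible a b) (p : ℝ[X]) :
    AbsolutelyContinuousOnInterval (fun x => jacobiWeight a b x * p.eval x) 0 1 := by
  refine absolutelyContinuousOnInterval_congr ((h.intervalIntegrable_weightedDeriv
    p).absolutelyContinuousOnInterval_intervalIntegral left_mem_uIcc) fun x hx => ?_
  rw [uIcc_of_le zero_le_one] at hx
  have := intervalIntegral.integral_eq_sub_of_hasDerivAt_of_le hx.1
    (h.continuous_weighted p).continuousOn
    (fun y hy => hasDerivAt_weighted a b p ⟨hy.1, hy.2.trans_le hx.2⟩)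
    ((h.intervalIntegrable_weightedDeriv p).mono_set (by
      rw [uIcc_of_le hx.1, uIcc_of_le zero_le_one]; exact Icc_subset_Icc_right hx.2))
  simpa [h.weighted_zero] using this

theorem memLp_weighted {a b : ℝ} (ha : -1 < a) (hb : -1 < b) (p : ℝ[X]) :
    MemLp (fun x => jacobiWeight a b x * p.eval x) 2 (jacobiMeasure (-a) (-b)) := by
  have hm : Measurable fun x => jacobiWeight a b x * p.eval x :=
    (measurable_jacobiWeight a b).mul p.continuous.measurable
  rw [memLp_two_iff_integrable_sq hm.aestronglyMeasurable, integrable_jacobiMeasure_iff]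
  refine (integrableOn_jacobiWeight_mul_eval ha hb (p * p)).congr_fun (fun x hx => ?_)
    measurableSet_Ioo
  have := jacobiWeight_mul (-a) (-b) a b hx
  simp only [neg_add_cancel] at this
  have e : jacobiWeight 0 0 x = 1 := by simp [jacobiWeight]
  rw [e] at this
  simp only [eval_mul]
  linear_combination -(jacobiWeight a b x * p.eval x ^ 2) * this

theorem wInner_weighted (a b : ℝ) (p q : ℝ[X]) :
    wInner (-a) (-b) (fun x => jacobiWeight a b x * p.eval x)
      (fun x => jacobiWeight a b x * q.eval x) = jacobiMoment a b (p * q) := by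
  refine setIntegral_congr_fun measurableSet_Ioo fun x hx => ?_
  have := jacobiWeight_mul (-a) (-b) a b hx
  simp only [neg_add_cancel] at this
  have e : jacobiWeight 0 0 x = 1 := by simp [jacobiWeight]
  rw [e] at this
  simp only [eval_mul]
  linear_combination (jacobiWeight a b x * p.eval x * q.eval x) * this

theorem Admissible.locallyIntegrable_kern {a b : ℝ} (h : Admissible a b) :
    LocallyIntegrable (kern a b) := by
  rw [locallyIntegrable_iff]
  intro k hk
  obtain ⟨R, hR⟩ := hk.isBounded.subset_closedBall 0
  rw [Real.closedBall_eq_Icc] at hR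
  rcases le_or_gt (0 - R) (0 + R) with hle | hlt
  · exact ((intervalIntegrable_iff_integrableOn_Icc_of_le hle).1
      (h.intervalIntegrable_kern _ _)).mono_set hR
  · rw [Icc_eq_empty hlt.not_ge, subset_empty_iff] at hR
    simp [hR]

/-- The support condition lets the integral run over the whole line; in convolution form,
differentiation falls on φ and avoids the singular kernel. -/
theorem integral_mul_kern_eq_convolution (a b x : ℝ) {φ : ℝ → ℝ} (hs : tsupport φ ⊆ Ioo (0 : ℝ) 1) :
    ∫ s in Ioo (0 : ℝ) 1, φ s * kern a b (x - s) =
      convolution (kern a b) φ (ContinuousLinearMap.lsmul ℝ ℝ) volume x := by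
  rw [convolution_eq_swap, setIntegral_eq_integral_of_forall_compl_eq_zero]
  · simp [mul_comm]
  · intro s hsx
    rw [image_eq_zero_of_notMem_tsupport (fun h => hsx (hs h)), zero_mul]

theorem Admissible.twoSidedFracInt_test {α a b x : ℝ} (h : Admissible a b) (hα : α = a + b)
    {φ : ℝ → ℝ} (hφ : Continuous φ) (hs : tsupport φ ⊆ Ioo (0 : ℝ) 1) (hx : x ∈ Ioo (0 : ℝ) 1) :
    twoSidedFracInt α (skewness a b) φ x = 1 / Real.Gamma (2 - α) *
      convolution (kern a b) φ (ContinuousLinearMap.lsmul ℝ ℝ) volume x := by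
  have h2 : -1 < 1 - a - b := by linarith [h.lt_two]
  rw [← integral_mul_kern_eq_convolution a b x hs]
  refine h.twoSidedFracInt_eq hα hx ?_ ?_
  · have := (intervalIntegral.intervalIntegrable_rpow' (a := 0) (b := x) h2).comp_sub_left x
    rw [sub_zero, sub_self] at this
    simpa only [mul_comm] using this.symm.mul_continuousOn hφ.continuousOn
  · have := (intervalIntegral.intervalIntegrable_rpow' (a := 0) (b := 1 - x) h2).comp_sub_right x
    rw [zero_add, sub_add_cancel] at this
    simpa only [mul_comm] using this.mul_continuousOn hφ.continuousOn

/-- On test functions the two-sided fractional integral commutes with the derivative. -/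
theorem Admissible.deriv_twoSidedFracInt_test {α a b x : ℝ} (h : Admissible a b) (hα : α = a + b)
    {φ : ℝ → ℝ} (hφ : ContDiff ℝ ∞ φ) (hc : HasCompactSupport φ) (hs : tsupport φ ⊆ Ioo (0 : ℝ) 1)
    (hx : x ∈ Ioo (0 : ℝ) 1) :
    deriv (twoSidedFracInt α (skewness a b) φ) x = 1 / Real.Gamma (2 - α) *
      convolution (kern a b) (deriv φ) (ContinuousLinearMap.lsmul ℝ ℝ) volume x := by
  refine HasDerivAt.deriv ?_
  refine ((hc.hasDerivAt_convolution_right (ContinuousLinearMap.lsmul ℝ ℝ) h.locallyIntegrable_kern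
    (hφ.of_le (by simp)) x).const_mul (1 / Real.Gamma (2 - α))).congr_of_eventuallyEq ?_
  filter_upwards [Ioo_mem_nhds hx.1 hx.2] with y hy
  exact h.twoSidedFracInt_test hα hφ.continuous hs hy

/-- Integration by parts against the convolution Ψ of φ with the transposed kernel has no boundary
terms, as the weight vanishes at 0 and 1. Fubini then moves the kernel from φ to the derivative of
the weighted polynomial. -/
theorem Admissible.weakEquation_weighted {α a b : ℝ} (h : Admissible a b) (hα : α = a + b)
    (p : ℝ[X]) : WeakEquation α (skewness a b) (fun x => jacobiWeight a b x * p.eval x)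
      (opL α (skewness a b) fun x => jacobiWeight a b x * p.eval x) := by
  intro φ hφ hc hs
  have hα' : α = b + a := by rw [hα, add_comm]
  have hφ1 : ContDiff ℝ 1 φ := hφ.of_le (by simp)
  rw [h.one_sub_skewness]
  set Ψ := convolution (kern b a) φ (ContinuousLinearMap.lsmul ℝ ℝ) volume with hΨ
  set Ψ' := convolution (kern b a) (deriv φ) (ContinuousLinearMap.lsmul ℝ ℝ) volume
  have hΨd : ∀ x, HasDerivAt Ψ (Ψ' x) x := fun x =>
    hc.hasDerivAt_convolution_right _ h.symm.locallyIntegrable_kern hφ1 x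
  have hΨ'c : Continuous Ψ' := hc.deriv.continuous_convolution_right _ h.symm.locallyIntegrable_kern
    (hφ1.continuous_deriv le_rfl)
  have hΨc : Continuous Ψ := continuous_iff_continuousAt.2 fun x => (hΨd x).continuousAt
  have hibp := intervalIntegral.integral_mul_deriv_eq_deriv_mul_of_hasDerivAt
    (h.continuous_weighted p).continuousOn hΨc.continuousOn (a := 0) (b := 1)
    (fun x hx => hasDerivAt_weighted a b p (by simpa using hx)) (fun x _ => hΨd x)
    (h.intervalIntegrable_weightedDeriv p) (hΨ'c.intervalIntegrable _ _)
  simp only [h.weighted_zero, h.weighted_one, zero_mul, sub_zero, zero_sub,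
    intervalIntegral.integral_of_le (zero_le_one (α := ℝ)), integral_Ioc_eq_integral_Ioo] at hibp
  have hF := h.integral_mul_abelOp (φ := φ) (hφ.continuous.integrableOn_Icc.mono_set
    Ioo_subset_Icc_self) (weightedDeriv a b p).continuous
  have e1 : ∫ x in Ioo (0 : ℝ) 1, jacobiWeight a b x * p.eval x *
      deriv (twoSidedFracInt α (skewness b a) φ) x =
      1 / Real.Gamma (2 - α) * ∫ x in Ioo (0 : ℝ) 1, jacobiWeight a b x * p.eval x * Ψ' x := by
    rw [← integral_const_mul]
    refine setIntegral_congr_fun measurableSet_Ioo fun x hx => ?_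
    simp only [h.symm.deriv_twoSidedFracInt_test hα' hφ hc hs hx]
    ring
  have e2 : ∫ x in Ioo (0 : ℝ) 1, opL α (skewness a b) (fun x => jacobiWeight a b x * p.eval x) x *
      φ x = -(1 / Real.Gamma (2 - α)) * ∫ x in Ioo (0 : ℝ) 1, φ x *
        abelOp a b (fun s => (weightedDeriv a b p).eval s) x := by
    rw [← integral_const_mul]
    refine setIntegral_congr_fun measurableSet_Ioo fun x hx => ?_
    simp only [h.opL_weighted hα hx]
    ring
  have e3 : ∀ s, ∫ y in Ioo (0 : ℝ) 1, φ y * kern a b (y - s) = Ψ s := by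
    intro s
    rw [hΨ, ← integral_mul_kern_eq_convolution b a s hs]
    congr 1; ext y
    rw [← kern_neg b a, neg_sub]
  simp only [e3] at hF
  rw [e1, e2, hibp, hF]
  ring

end Operator

/-! ### Convergence of the series and solvability for data orthogonal to constants. -/

section Solution

theorem norm_sq_sum_of_orthogonal {E : Type*} [NormedAddCommGroup E] [InnerProductSpace ℝ E]
    {x : ℕ → E} (hx : ∀ i j, i ≠ j → inner ℝ (x i) (x j) = 0) (s : Finset ℕ) :
    ‖∑ j ∈ s, x j‖ ^ 2 = ∑ j ∈ s, ‖x j‖ ^ 2 := by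
  rw [← real_inner_self_eq_norm_sq, sum_inner]
  refine Finset.sum_congr rfl fun i hi => ?_
  rw [inner_sum, Finset.sum_eq_single i (fun j _ hj => hx i j hj.symm) (fun h => absurd hi h),
    real_inner_self_eq_norm_sq]

/-- By Pythagoras, a termwise comparison of squared norms carries over to the tails. -/
theorem cauchySeq_sum_of_orthogonal {E F : Type*} [NormedAddCommGroup E] [InnerProductSpace ℝ E]
    [NormedAddCommGroup F] [InnerProductSpace ℝ F] {x : ℕ → E} {y : ℕ → F}
    (hx : ∀ i j, i ≠ j → inner ℝ (x i) (x j) = 0) (hy : ∀ i j, i ≠ j → inner ℝ (y i) (y j) = 0)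
    {c : ℝ} (hc : 0 ≤ c) (hxy : ∀ j, ‖x j‖ ^ 2 ≤ c * ‖y j‖ ^ 2)
    (h : CauchySeq fun N => ∑ j ∈ Finset.range N, y j) :
    CauchySeq fun N => ∑ j ∈ Finset.range N, x j := by
  rw [Metric.cauchySeq_iff'] at h ⊢
  intro ε hε
  -- Using c + 1 instead of c keeps the divisor positive when c = 0 and makes the final inequality
  -- strict.
  obtain ⟨N, hN⟩ := h (ε / Real.sqrt (c + 1)) (by positivity)
  refine ⟨N, fun n hn => ?_⟩
  have h1 := hN n hn
  rw [dist_eq_norm, ← Finset.sum_Ico_eq_sub _ hn] at h1 ⊢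
  have h2 : ‖∑ j ∈ Finset.Ico N n, x j‖ ^ 2 ≤ c * ‖∑ j ∈ Finset.Ico N n, y j‖ ^ 2 := by
    rw [norm_sq_sum_of_orthogonal hx, norm_sq_sum_of_orthogonal hy, Finset.mul_sum]
    exact Finset.sum_le_sum fun j _ => hxy j
  have h3 : ‖∑ j ∈ Finset.Ico N n, y j‖ ^ 2 ≤ ε ^ 2 / (c + 1) := by
    have := pow_le_pow_left₀ (norm_nonneg _) h1.le 2
    rwa [div_pow, Real.sq_sqrt (by positivity)] at this
  refine lt_of_pow_lt_pow_left₀ 2 hε.le (h2.trans_lt ((mul_le_mul_of_nonneg_left h3 hc).trans_lt ?_))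
  rw [← mul_div_assoc, div_lt_iff₀ (by positivity)]
  nlinarith [sq_pos_of_pos hε]

/-- With nonpositive exponents the weight is at least 1, so weighted L² convergence implies L² and
hence L¹ convergence on the unit interval; k is bounded. -/
theorem tendsto_setIntegral_mul {a b : ℝ} (ha : a ≤ 0) (hb : b ≤ 0) {F : ℕ → ℝ → ℝ} {f k : ℝ → ℝ}
    {C : ℝ} (hF : ∀ n, MemLp (F n) 2 (jacobiMeasure a b)) (hf : MemLp f 2 (jacobiMeasure a b))
    (hk : AEStronglyMeasurable k (volume.restrict (Ioo (0 : ℝ) 1)))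
    (hkC : ∀ x ∈ Ioo (0 : ℝ) 1, |k x| ≤ C)
    (hlim : Tendsto (fun n => eLpNorm (fun x => F n x - f x) 2 (jacobiMeasure a b)) atTop (𝓝 0)) :
    Tendsto (fun n => ∫ x in Ioo (0 : ℝ) 1, F n x * k x) atTop
      (𝓝 (∫ x in Ioo (0 : ℝ) 1, f x * k x)) := by
  have : IsProbabilityMeasure (volume.restrict (Ioo (0 : ℝ) 1)) := ⟨by simp⟩
  have hle := restrict_le_jacobiMeasure ha hb
  have hkC' : ∀ᵐ x ∂volume.restrict (Ioo (0 : ℝ) 1), ‖k x‖ ≤ C := by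
    filter_upwards [ae_restrict_mem measurableSet_Ioo] with x hx using hkC x hx
  have hint : ∀ g : ℝ → ℝ, MemLp g 2 (jacobiMeasure a b) →
      Integrable g (volume.restrict (Ioo (0 : ℝ) 1)) := fun g hg =>
    (hg.mono_measure hle).integrable (by norm_num)
  refine tendsto_integral_of_L1' _ ((hint f hf).mul_bdd hk hkC').1
    (Eventually.of_forall fun n => (hint _ (hF n)).mul_bdd hk hkC') ?_
  have hbound : ∀ n, eLpNorm ((fun x => F n x * k x) - fun x => f x * k x) 1
      (volume.restrict (Ioo (0 : ℝ) 1)) ≤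
      ENNReal.ofReal C * eLpNorm (fun x => F n x - f x) 2 (jacobiMeasure a b) := by
    intro n
    have h1 : eLpNorm ((fun x => F n x * k x) - fun x => f x * k x) 1
        (volume.restrict (Ioo (0 : ℝ) 1)) ≤ ENNReal.ofReal C *
        eLpNorm (fun x => F n x - f x) 1 (volume.restrict (Ioo (0 : ℝ) 1)) := by
      refine eLpNorm_le_mul_eLpNorm_of_ae_le_mul ?_ 1
      filter_upwards [hkC'] with x hx
      rw [Pi.sub_apply, ← sub_mul, norm_mul, mul_comm]
      exact mul_le_mul_of_nonneg_right hx (norm_nonneg _)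
    refine h1.trans (mul_le_mul_right ?_ _)
    refine (eLpNorm_le_eLpNorm_of_exponent_le (by norm_num)
      ((hF n).sub hf |>.mono_measure hle).1).trans (eLpNorm_mono_measure _ hle)
  refine tendsto_of_tendsto_of_tendsto_of_le_of_le tendsto_const_nhds ?_ (fun _ => zero_le) hbound
  have := ENNReal.Tendsto.const_mul hlim (a := ENNReal.ofReal C) (Or.inr ENNReal.ofReal_ne_top)
  rwa [mul_zero] at this

/-- A weighted polynomial as an element of the dual weighted space. -/
def weightedLp {a b : ℝ} (ha : -1 < a) (hb : -1 < b) :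
    ℝ[X] →ₗ[ℝ] Lp ℝ 2 (jacobiMeasure (-a) (-b)) where
  toFun p := (memLp_weighted ha hb p).toLp _
  map_add' p q := by
    rw [← MemLp.toLp_add]
    exact MemLp.toLp_congr _ _ (Eventually.of_forall fun x => by simp [mul_add])
  map_smul' c p := by
    rw [RingHom.id_apply, ← MemLp.toLp_const_smul]
    exact MemLp.toLp_congr _ _ (Eventually.of_forall fun x => by simp [mul_left_comm])

theorem inner_weightedLp {a b : ℝ} (ha : -1 < a) (hb : -1 < b) (p q : ℝ[X]) :
    inner ℝ (weightedLp ha hb p) (weightedLp ha hb q) = jacobiMoment a b (p * q) :=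
  (inner_toLp (memLp_weighted ha hb p) (memLp_weighted ha hb q)).trans (wInner_weighted a b p q)

theorem eigenvalue_succ {α β : ℝ} (hα : 0 < α) (j : ℕ) :
    eigenvalue α β (j + 1) = eigenvalue α β j * ((j + α) / (j + 1)) := by
  have e : Real.Gamma (((j + 1 : ℕ) : ℝ) + α) = (j + α) * Real.Gamma (j + α) := by
    rw [← Real.Gamma_add_one (by positivity)]
    congr 1; push_cast; ring
  unfold eigenvalue
  rw [e, Nat.factorial_succ, mul_assoc]
  push_cast
  congr 1
  field_simp

theorem Admissible.abs_eigenvalue_pos {α β : ℝ} (h : Admissible (α - β) β) (hα₁ : 1 < α)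
    (hα₂ : α < 2) : 0 < |eigenvalue α β 0| := by
  rw [abs_pos]
  have h1 : Real.sin (Real.pi * (α - 1)) = -Real.sin (Real.pi * α) := by
    rw [mul_sub, mul_one, Real.sin_sub_pi]
  have h2 : 0 < Real.sin (Real.pi * (α - 1)) := sin_pi_mul_pos (by linarith) (by linarith)
  have h3 := h.sin_add_sin_pos
  have h4 := Real.Gamma_pos_of_pos (show 0 < α by linarith)
  have h5 : Real.sin (Real.pi * α) ≠ 0 := by intro h0; rw [h1, h0] at h2; simp at h2
  simp only [eigenvalue, Nat.cast_zero, zero_add, Nat.factorial_zero, Nat.cast_one, div_one]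
  positivity

/-- Consecutive eigenvalues have ratio (j+α)/(j+1), which exceeds 1. -/
theorem abs_eigenvalue_zero_le {α β : ℝ} (hα₁ : 1 < α) (j : ℕ) :
    |eigenvalue α β 0| ≤ |eigenvalue α β j| := by
  induction j with
  | zero => exact le_rfl
  | succ j ih =>
    rw [eigenvalue_succ (by linarith), abs_mul]
    refine ih.trans (le_mul_of_one_le_right (abs_nonneg _) ((le_abs_self _).trans' ?_))
    rw [one_le_div (by positivity)]
    linarith

/-- The norm recursion gives the ratio (j+a+b)/(j+1), at least 1 because a + b > 1; reflection x ↦ 1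
- x supplies the exchange of exponents. -/
theorem Admissible.jacobiMoment_sq_le {a b : ℝ} (h : Admissible a b) (j : ℕ) :
    jacobiMoment a b (jacobiPoly j a b * jacobiPoly j a b) ≤ jacobiMoment (b - 1) (a - 1)
      (jacobiPoly (j + 1) (b - 1) (a - 1) * jacobiPoly (j + 1) (b - 1) (a - 1)) := by
  have h1 := jacobiMoment_sq_succ (a := b - 1) (b := a - 1) (by linarith [h.pos_right])
    (by linarith [h.pos_left]) j
  rw [sub_add_cancel, sub_add_cancel, jacobiMoment_sq_swap j b a] at h1
  have h2 := jacobiMoment_sq_pos (a := a) (b := b) (by linarith [h.pos_left])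
    (by linarith [h.pos_right]) (jacobiPoly_ne_zero j (a := a) (b := b) (by linarith [h.one_lt]))
  have h3 : (0 : ℝ) ≤ j := Nat.cast_nonneg j
  have h4 := h.one_lt
  nlinarith

/-- The solution of `L_r^α u = g` for a right hand side orthogonal to the constants. -/
theorem Admissible.exists_solution {α β : ℝ} (h : Admissible (α - β) β) {g : ℝ → ℝ}
    (hg : MemLp g 2 (jacobiMeasure (β - 1) (α - β - 1))) (hg₀ : jacobiCoeff α β g 0 = 0) :
    ∃ u : ℝ → ℝ, SolvesDirichlet α (skewness (α - β) β) β u g ∧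
      Tendsto (fun N => eLpNorm (fun x => jacobiWeight (α - β) β x * (∑ j ∈ Finset.range N,
        (-jacobiCoeff α β g (j + 1) / eigenvalue α β j) * jacobiG j (α - β) β x) - u x) 2
        (jacobiMeasure (-(α - β)) (-β))) atTop (𝓝 0) := by
  have hα : α = (α - β) + β := by ring
  have hα₁ : 1 < α := by linarith [h.one_lt]
  have hα₂ : α < 2 := by linarith [h.lt_two]
  have ha : -1 < α - β := by linarith [h.pos_left]
  have hb : -1 < β := by linarith [h.pos_right]
  have ha' : -1 < α - β - 1 := by linarith [h.pos_left]
  have hb' : -1 < β - 1 := by linarith [h.pos_right]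
  set d : ℕ → ℝ := fun j => jacobiCoeff α β g j with hd
  set c : ℕ → ℝ := fun j => -d (j + 1) / eigenvalue α β j with hc
  have hl0 := h.abs_eigenvalue_pos hα₁ hα₂
  have hlam : ∀ j, eigenvalue α β j ≠ 0 := fun j =>
    abs_pos.1 (hl0.trans_le (abs_eigenvalue_zero_le hα₁ j))
  set P : ℕ → ℝ[X] := fun N => ∑ j ∈ Finset.range N, C (c j) * jacobiPoly j (α - β) β with hP
  set Q : ℕ → ℝ[X] := fun N => ∑ j ∈ Finset.range N,
    C (d (j + 1)) * jacobiPoly (j + 1) (β - 1) (α - β - 1) with hQ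
  set v : ℕ → ℝ → ℝ := fun N x => jacobiWeight (α - β) β x * (P N).eval x with hv
  have hop : ∀ N, ∀ x ∈ Ioo (0 : ℝ) 1, opL α (skewness (α - β) β) (v N) x = (Q N).eval x := by
    intro N x hx
    have := h.opL_sum hα hx N c
    refine this.trans ?_
    rw [hQ, eval_finsetSum]
    refine Finset.sum_congr rfl fun j _ => ?_
    rw [eval_mul, eval_C, eval_jacobiPoly, hc]
    simp only
    rw [div_mul_cancel₀ _ (hlam j), neg_neg]
  have hopae : ∀ N, opL α (skewness (α - β) β) (v N)
      =ᵐ[jacobiMeasure (β - 1) (α - β - 1)] fun x => (Q N).eval x := fun N => by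
    filter_upwards [ae_mem_jacobiMeasure (β - 1) (α - β - 1)] with x hx using hop N x hx
  have hQlim : Tendsto (fun N => eLpNorm (fun x => (Q N).eval x - g x) 2
      (jacobiMeasure (β - 1) (α - β - 1))) atTop (𝓝 0) := by
    -- The index shifts by one because the zeroth coefficient of g vanishes.
    refine ((tendsto_jacobi_expansion hb' ha' hg).comp (tendsto_add_atTop_nat 1)).congr fun N => ?_
    simp only [Function.comp]
    congr 1; ext x
    congr 1
    rw [Finset.sum_range_succ', hQ, eval_finsetSum]
    have h0 : wInner (β - 1) (α - β - 1) g (jacobiG 0 (β - 1) (α - β - 1)) /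
      wInner (β - 1) (α - β - 1) (jacobiG 0 (β - 1) (α - β - 1))
        (jacobiG 0 (β - 1) (α - β - 1)) = 0 := hg₀
    rw [h0, zero_mul, add_zero]
    refine Finset.sum_congr rfl fun j _ => ?_
    rw [eval_mul, eval_C, eval_jacobiPoly]
    rfl
  have hQc : CauchySeq fun N => ∑ j ∈ Finset.range N,
      polyLp hb' ha' (C (d (j + 1)) * jacobiPoly (j + 1) (β - 1) (α - β - 1)) := by
    have := ((Lp.tendsto_Lp_iff_tendsto_eLpNorm'' _ (fun N => memLp_eval hb' ha' (Q N)) g hg).2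
      hQlim).cauchySeq
    have e : (fun N => ∑ j ∈ Finset.range N, polyLp hb' ha'
        (C (d (j + 1)) * jacobiPoly (j + 1) (β - 1) (α - β - 1))) =
        fun N => (memLp_eval hb' ha' (Q N)).toLp _ := by
      ext1 N
      rw [← map_sum]
      rfl
    rwa [e]
  have hmul : ∀ (s t : ℝ) (p q : ℝ[X]), (C s * p) * (C t * q) = C (s * t) * (p * q) := by
    intro s t p q; rw [C_mul]; ring
  have hPc : CauchySeq fun N => ∑ j ∈ Finset.range N,
      weightedLp ha hb (C (c j) * jacobiPoly j (α - β) β) := by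
    refine cauchySeq_sum_of_orthogonal (c := 1 / eigenvalue α β 0 ^ 2) (fun i j hij => ?_)
      (fun i j hij => ?_) (by positivity) (fun j => ?_) hQc
    · rw [inner_weightedLp, hmul, jacobiMoment_C_mul, jacobiMoment_orthogonal ha hb hij, mul_zero]
    · rw [inner_polyLp, hmul, jacobiMoment_C_mul, jacobiMoment_orthogonal hb' ha' (by simpa using hij),
        mul_zero]
    · rw [← real_inner_self_eq_norm_sq, ← real_inner_self_eq_norm_sq, inner_weightedLp, inner_polyLp,
        hmul, hmul, jacobiMoment_C_mul, jacobiMoment_C_mul]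
      have h1 := h.jacobiMoment_sq_le j
      have h2 : c j * c j ≤ 1 / eigenvalue α β 0 ^ 2 * (d (j + 1) * d (j + 1)) := by
        have h3 : eigenvalue α β 0 ^ 2 ≤ eigenvalue α β j ^ 2 :=
          sq_le_sq.2 (abs_eigenvalue_zero_le hα₁ j)
        have h4 : 0 < eigenvalue α β 0 ^ 2 := by have := hlam 0; positivity
        have e : c j * c j = 1 / eigenvalue α β j ^ 2 * (d (j + 1) * d (j + 1)) := by
          simp only [hc]
          have := hlam j
          field_simp
        rw [e]
        exact mul_le_mul_of_nonneg_right (one_div_le_one_div_of_le h4 h3) (mul_self_nonneg _)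
      rw [← mul_assoc]
      refine mul_le_mul h2 h1 ?_ (mul_nonneg (by positivity) (mul_self_nonneg _))
      exact (jacobiMoment_sq_pos ha hb (jacobiPoly_ne_zero j (by linarith))).le
  obtain ⟨U, hU⟩ := cauchySeq_tendsto_of_complete hPc
  have hUL := Lp.memLp U
  have hvL : ∀ N, MemLp (v N) 2 (jacobiMeasure (-(α - β)) (-β)) := fun N => memLp_weighted ha hb (P N)
  have hvlim : Tendsto (fun N => eLpNorm (fun x => v N x - U x) 2 (jacobiMeasure (-(α - β)) (-β)))
      atTop (𝓝 0) := by
    refine (Lp.tendsto_Lp_iff_tendsto_eLpNorm'' v hvL U hUL).1 ?_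
    rw [Lp.toLp_coeFn]
    refine hU.congr fun N => ?_
    rw [← map_sum]
    rfl
  have hoplim : Tendsto (fun N => eLpNorm (fun x => opL α (skewness (α - β) β) (v N) x - g x) 2
      (jacobiMeasure (β - 1) (α - β - 1))) atTop (𝓝 0) := by
    refine hQlim.congr fun N => eLpNorm_congr_ae ?_
    filter_upwards [hopae N] with x hx
    rw [hx]
  have hopL : ∀ N, MemLp (opL α (skewness (α - β) β) (v N)) 2 (jacobiMeasure (β - 1) (α - β - 1)) :=
    fun N => (memLp_eval hb' ha' (Q N)).ae_eq (hopae N).symm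
  refine ⟨U, ⟨hUL, hg, ?_, v, fun N => ⟨h.absolutelyContinuous_weighted (P N), ?_, ?_, hvL N, hopL N⟩,
    hvlim, hoplim⟩, ?_⟩
  -- Both sides of the weak equation for the partial sums converge: the derivative of the transposed
  -- integral of φ and φ itself are bounded on (0,1).
  · intro φ hφ hc hs
    have hα' : α = β + (α - β) := by ring
    rw [h.one_sub_skewness]
    have hΨ'c : Continuous (convolution (kern β (α - β)) (deriv φ) (ContinuousLinearMap.lsmul ℝ ℝ)
        volume) := hc.deriv.continuous_convolution_right _ h.symm.locallyIntegrable_kern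
      ((hφ.of_le (by simp) : ContDiff ℝ 1 φ).continuous_deriv le_rfl)
    obtain ⟨B, hB⟩ := isCompact_Icc.exists_bound_of_continuousOn (s := Icc (0 : ℝ) 1)
      (hΨ'c.const_smul (1 / Real.Gamma (2 - α))).continuousOn
    obtain ⟨B', hB'⟩ := isCompact_Icc.exists_bound_of_continuousOn (s := Icc (0 : ℝ) 1)
      hφ.continuous.continuousOn
    have t1 := tendsto_setIntegral_mul (a := -(α - β)) (b := -β) (C := B)
      (k := deriv (twoSidedFracInt α (skewness β (α - β)) φ)) (by linarith [h.pos_left])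
      (by linarith [h.pos_right]) hvL hUL (measurable_deriv _).aestronglyMeasurable (fun x hx => by
        rw [h.symm.deriv_twoSidedFracInt_test hα' hφ hc hs hx]
        exact hB x (Ioo_subset_Icc_self hx)) hvlim
    have t2 := tendsto_setIntegral_mul (a := β - 1) (b := α - β - 1) (C := B') (k := φ)
      (by linarith [h.right_le]) (by linarith [h.left_le]) hopL hg
      hφ.continuous.aestronglyMeasurable (fun x hx => hB' x (Ioo_subset_Icc_self hx)) hoplim
    refine tendsto_nhds_unique t1 (t2.congr fun N => ?_)
    have := h.weakEquation_weighted hα (P N) φ hφ hc hs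
    rw [h.one_sub_skewness] at this
    exact this.symm
  · simp [hv, h.weighted_zero]
  · simp [hv, h.weighted_one]
  · refine hvlim.congr fun N => ?_
    congr 1; ext x
    simp only [hv, hP, eval_finsetSum, eval_mul, eval_C, eval_jacobiPoly]
    rfl

end Solution

/-! ### Integrability of the data built from f and K. -/

section Data

/-- With w = ω^{(b,a)}, |f| ≤ w f² + 1/w. The factor y^{-a} of 1/w is integrable at 0 for a < 1. On
(0,x), (1-y)^{-b} splits into (1-y)^{-b/4} ≤ (1-x)^{-b/4} and (1-y)^{-3b/4}, integrable since b ≤ 1.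
-/
theorem exists_primitive_bound {a b : ℝ} (hb₀ : 0 < b) (hb₁ : b ≤ 1) {f : ℝ → ℝ}
    (hf : MemLp f 2 (jacobiMeasure b a)) (ha : a < 1 ∨ IntegrableOn f (Ioo (0 : ℝ) 1)) :
    ∃ c : ℝ, ∀ x ∈ Ioo (0 : ℝ) 1, IntervalIntegrable f volume 0 x ∧
      |∫ y in (0 : ℝ)..x, f y| ≤ c * (1 - x) ^ (-(b / 4)) := by
  obtain ⟨H, hH, hfH⟩ : ∃ H : ℝ → ℝ, IntegrableOn H (Ioo (0 : ℝ) 1) ∧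
      ∀ x ∈ Ioo (0 : ℝ) 1, ∀ y ∈ Ioo 0 x, |f y| ≤ (1 - x) ^ (-(b / 4)) * H y := by
    rcases ha with ha | hint
    · have h1 := (integrable_jacobiMeasure_iff b a _).1 ((memLp_two_iff_integrable_sq hf.1).1 hf)
      have h2 := integrableOn_jacobiWeight (a := -(3 * b / 4)) (b := -a) (by linarith) (by linarith)
      refine ⟨_, h1.add h2, fun x hx y hy => ?_⟩
      have hy' : y ∈ Ioo (0 : ℝ) 1 := ⟨hy.1, hy.2.trans hx.2⟩
      have hx1 : 0 < 1 - x := sub_pos.2 hx.2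
      have hy1 : 0 < 1 - y := sub_pos.2 hy'.2
      have w1 := jacobiWeight_pos b a hy'
      have w2 := jacobiWeight_pos (-(3 * b / 4)) (-a) hy'
      have hE : 1 ≤ (1 - x) ^ (-(b / 4)) :=
        Real.one_le_rpow_of_pos_of_le_one_of_nonpos hx1 (by linarith [hx.1]) (by linarith)
      have hinv : jacobiWeight b a y * jacobiWeight (-b) (-a) y = 1 := by
        rw [jacobiWeight_mul _ _ _ _ hy']; simp [jacobiWeight]
      have hle : jacobiWeight (-b) (-a) y ≤
          (1 - x) ^ (-(b / 4)) * jacobiWeight (-(3 * b / 4)) (-a) y := by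
        unfold jacobiWeight
        rw [← mul_assoc, show -b = -(b / 4) + -(3 * b / 4) by ring, Real.rpow_add hy1]
        refine mul_le_mul_of_nonneg_right (mul_le_mul_of_nonneg_right ?_ (Real.rpow_nonneg hy1.le _))
          (Real.rpow_nonneg hy.1.le _)
        exact Real.rpow_le_rpow_of_nonpos hx1 (by linarith [hy.2]) (by linarith)
      have w3 := jacobiWeight_pos (-b) (-a) hy'
      have hamgm : |f y| ≤ jacobiWeight b a y * f y ^ 2 + jacobiWeight (-b) (-a) y := by
        have h3 : 0 ≤ jacobiWeight b a y * (|f y| - jacobiWeight (-b) (-a) y) ^ 2 :=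
          mul_nonneg w1.le (sq_nonneg _)
        have h4 : jacobiWeight b a y * (|f y| - jacobiWeight (-b) (-a) y) ^ 2 =
            jacobiWeight b a y * f y ^ 2 - 2 * |f y| + jacobiWeight (-b) (-a) y := by
          rw [← sq_abs (f y)]
          linear_combination (jacobiWeight (-b) (-a) y - 2 * |f y|) * hinv
        linarith [abs_nonneg (f y)]
      refine hamgm.trans ?_
      rw [Pi.add_apply, mul_add]
      exact add_le_add (le_mul_of_one_le_left (mul_nonneg w1.le (sq_nonneg _)) hE) hle
    · refine ⟨_, hint.norm, fun x hx y _ => ?_⟩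
      exact le_mul_of_one_le_left (abs_nonneg _) (Real.one_le_rpow_of_pos_of_le_one_of_nonpos
        (sub_pos.2 hx.2) (by linarith [hx.1]) (by linarith))
  refine ⟨∫ y in Ioo (0 : ℝ) 1, |H y|, fun x hx => ?_⟩
  have hsub : Ioo 0 x ⊆ Ioo (0 : ℝ) 1 := Ioo_subset_Ioo_right hx.2.le
  have hx1 : 0 < 1 - x := sub_pos.2 hx.2
  have hE := Real.rpow_nonneg hx1.le (-(b / 4))
  have hfm : AEStronglyMeasurable f (volume.restrict (Ioo (0 : ℝ) 1)) :=
    hf.1.mono_ac (absolutelyContinuous_jacobiMeasure b a)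
  have hHx := (hH.mono_set hsub).const_mul ((1 - x) ^ (-(b / 4)))
  have hfi : IntegrableOn f (Ioo 0 x) := by
    refine Integrable.mono' hHx (hfm.mono_set hsub) ?_
    filter_upwards [ae_restrict_mem measurableSet_Ioo] with y hy using hfH x hx y hy
  refine ⟨(intervalIntegrable_iff_integrableOn_Ioo_of_le hx.1.le).2 hfi, ?_⟩
  rw [intervalIntegral.integral_of_le hx.1.le, integral_Ioc_eq_integral_Ioo]
  calc |∫ y in Ioo 0 x, f y| ≤ ∫ y in Ioo 0 x, |f y| := abs_integral_le_integral_abs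
    _ ≤ ∫ y in Ioo 0 x, (1 - x) ^ (-(b / 4)) * |H y| := by
      refine setIntegral_mono_on hfi.abs ((hH.mono_set hsub).abs.const_mul _) measurableSet_Ioo
        fun y hy => (hfH x hx y hy).trans (mul_le_mul_of_nonneg_left (le_abs_self _) hE)
    _ = (1 - x) ^ (-(b / 4)) * ∫ y in Ioo 0 x, |H y| := integral_const_mul _ _
    _ ≤ (1 - x) ^ (-(b / 4)) * ∫ y in Ioo (0 : ℝ) 1, |H y| := by
      refine mul_le_mul_of_nonneg_left (setIntegral_mono_set hH.abs
        (Eventually.of_forall fun _ => abs_nonneg _) hsub.eventuallyLE) hE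
    _ = _ := mul_comm _ _

/-- Integrability up to 1 is not available, so continuity at x is read off on [0,z] for some x < z <
1. -/
theorem continuousOn_primitive_Ico {f : ℝ → ℝ}
    (hf : ∀ x ∈ Ioo (0 : ℝ) 1, IntervalIntegrable f volume 0 x) :
    ContinuousOn (fun x => ∫ y in (0 : ℝ)..x, f y) (Ico 0 1) := by
  intro x hx
  obtain ⟨z, hxz, hz⟩ := exists_between hx.2
  have hz0 : 0 < z := hx.1.trans_lt hxz
  have h := intervalIntegral.continuousOn_primitive_interval
    (((intervalIntegrable_iff_integrableOn_Icc_of_le hz0.le).1 (hf z ⟨hz0, hz⟩)).mono_set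
      (uIcc_of_le hz0.le).subset)
  rw [uIcc_of_le hz0.le] at h
  refine (h x ⟨hx.1, hxz.le⟩).mono_of_mem_nhdsWithin ?_
  rw [mem_nhdsWithin]
  exact ⟨Iio z, isOpen_Iio, hxz, fun y hy => ⟨hy.2.1, le_of_lt hy.1⟩⟩

/-- Squaring the bound gives (1-x)^{-b/2}; against the weight factor (1-x)^{b-1} this leaves
(1-x)^{b/2-1}, which is integrable. -/
theorem memLp_f₁ {a b Km : ℝ} (ha : 0 < a) (hb : 0 < b) {K f : ℝ → ℝ} (hKm : 0 < Km)
    (hKmeas : AEMeasurable K (volume.restrict (Ioo (0 : ℝ) 1)))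
    (hK : ∀ x ∈ Ioo (0 : ℝ) 1, Km ≤ K x) {c : ℝ}
    (hf : ∀ x ∈ Ioo (0 : ℝ) 1, IntervalIntegrable f volume 0 x ∧
      |∫ y in (0 : ℝ)..x, f y| ≤ c * (1 - x) ^ (-(b / 4))) :
    MemLp (f₁ K f) 2 (jacobiMeasure (b - 1) (a - 1)) := by
  have hF : AEStronglyMeasurable (fun x => ∫ y in (0 : ℝ)..x, f y) (volume.restrict (Ioo (0 : ℝ) 1)) :=
    ((continuousOn_primitive_Ico fun x hx => (hf x hx).1).mono
      Ioo_subset_Ico_self).aestronglyMeasurable measurableSet_Ioo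
  have hK' : AEStronglyMeasurable (fun x => 1 / K x) (volume.restrict (Ioo (0 : ℝ) 1)) :=
    (hKmeas.const_div 1).aestronglyMeasurable
  have hm : AEStronglyMeasurable (f₁ K f) (volume.restrict (Ioo (0 : ℝ) 1)) := hK'.mul hF
  rw [memLp_two_iff_integrable_sq (hm.mono_ac (jacobiMeasure_absolutelyContinuous _ _)),
    integrable_jacobiMeasure_iff]
  have hi := (integrableOn_jacobiWeight (a := b / 2 - 1) (b := a - 1) (by linarith)
    (by linarith)).const_mul ((1 / Km * c) ^ 2)
  refine Integrable.mono' hi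
    ((measurable_jacobiWeight _ _).aestronglyMeasurable.mul (hm.pow 2)) ?_
  filter_upwards [ae_restrict_mem measurableSet_Ioo] with x hx
  have hx1 : 0 < 1 - x := sub_pos.2 hx.2
  have hw := jacobiWeight_pos (b - 1) (a - 1) hx
  have hE := Real.rpow_nonneg hx1.le (-(b / 4))
  have h1 : |f₁ K f x| ≤ 1 / Km * (c * (1 - x) ^ (-(b / 4))) := by
    have hKx := hKm.trans_le (hK x hx)
    rw [f₁, abs_mul, abs_of_pos (one_div_pos.2 hKx)]
    exact mul_le_mul (one_div_le_one_div_of_le hKm (hK x hx)) (hf x hx).2 (abs_nonneg _)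
      (one_div_pos.2 hKm).le
  have h2 : f₁ K f x ^ 2 ≤ (1 / Km * (c * (1 - x) ^ (-(b / 4)))) ^ 2 := by
    rw [← sq_abs]
    exact pow_le_pow_left₀ (abs_nonneg _) h1 2
  rw [norm_mul, Real.norm_of_nonneg hw.le, Real.norm_of_nonneg (sq_nonneg _)]
  refine (mul_le_mul_of_nonneg_left h2 hw.le).trans (le_of_eq ?_)
  have e1 : ((1 - x) ^ (-(b / 4))) ^ 2 = (1 - x) ^ (-(b / 2)) := by
    rw [← Real.rpow_natCast, ← Real.rpow_mul hx1.le]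
    congr 1; push_cast; ring
  have e2 : (1 - x) ^ (b / 2 - 1) = (1 - x) ^ (b - 1) * (1 - x) ^ (-(b / 2)) := by
    rw [← Real.rpow_add hx1]; congr 1; ring
  rw [mul_pow, mul_pow, e1, jacobiWeight, jacobiWeight, e2]
  ring

theorem memLp_f₂ {a b Km : ℝ} (ha : -1 < a) (hb : -1 < b) {K : ℝ → ℝ} (hKm : 0 < Km)
    (hKmeas : AEMeasurable K (volume.restrict (Ioo (0 : ℝ) 1)))
    (hK : ∀ x ∈ Ioo (0 : ℝ) 1, Km ≤ K x) : MemLp (f₂ K) 2 (jacobiMeasure a b) := by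
  have := isFiniteMeasure_jacobiMeasure ha hb
  refine MemLp.of_bound ((hKmeas.const_div 1).aestronglyMeasurable.mono_ac
    (jacobiMeasure_absolutelyContinuous _ _)) (1 / Km) ?_
  filter_upwards [ae_mem_jacobiMeasure a b] with x hx
  have hKx := hKm.trans_le (hK x hx)
  rw [f₂, Real.norm_of_nonneg (one_div_pos.2 hKx).le]
  exact one_div_le_one_div_of_le hKm (hK x hx)

theorem wInner_inv_pos {a b Km KM : ℝ} (ha : -1 < a) (hb : -1 < b) {K : ℝ → ℝ} (hKm : 0 < Km)
    (hKmeas : AEMeasurable K (volume.restrict (Ioo (0 : ℝ) 1)))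
    (hK : ∀ x ∈ Ioo (0 : ℝ) 1, Km ≤ K x ∧ K x ≤ KM) :
    0 < wInner a b (fun x => (K x)⁻¹) (fun _ => 1) := by
  have := isFiniteMeasure_jacobiMeasure ha hb
  have h2 := (memLp_f₂ ha hb hKm hKmeas fun x hx => (hK x hx).1).integrable (by norm_num)
  rw [integrable_jacobiMeasure_iff] at h2
  have hKM : 0 < KM := by
    have := hK (1 / 2) (by norm_num)
    linarith [this.1, this.2]
  have h3 : 0 < ∫ x in Ioo (0 : ℝ) 1, jacobiWeight a b x * KM⁻¹ := by
    rw [integral_mul_const]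
    have e := integral_jacobiWeight (p := b + 1) (q := a + 1) (by linarith) (by linarith)
    rw [add_sub_cancel_right, add_sub_cancel_right] at e
    rw [e]
    exact mul_pos (ProbabilityTheory.beta_pos (by linarith) (by linarith)) (inv_pos.2 hKM)
  refine h3.trans_le ?_
  unfold wInner
  simp only [mul_one]
  refine setIntegral_mono_on ((integrableOn_jacobiWeight ha hb).mul_const _) ?_ measurableSet_Ioo
    fun x hx => ?_
  · refine h2.congr (Eventually.of_forall fun x => ?_)
    simp [f₂]
  · exact mul_le_mul_of_nonneg_left (inv_anti₀ (hKm.trans_le (hK x hx).1) (hK x hx).2)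
      (jacobiWeight_pos a b hx).le

theorem wInner_sub_const_mul {a b c : ℝ} {g h k : ℝ → ℝ} (hg : MemLp g 2 (jacobiMeasure a b))
    (hh : MemLp h 2 (jacobiMeasure a b)) (hk : MemLp k 2 (jacobiMeasure a b)) :
    wInner a b (fun x => g x - c * h x) k = wInner a b g k - c * wInner a b h k := by
  simp only [wInner_eq_integral]
  have h1 : Integrable (fun x => g x * k x) (jacobiMeasure a b) := hg.integrable_mul hk
  have h2 : Integrable (fun x => h x * k x) (jacobiMeasure a b) := hh.integrable_mul hk
  rw [← integral_const_mul, ← integral_sub h1 (h2.const_mul c)]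
  congr 1; ext x; ring

theorem memLp_jacobiG {a b : ℝ} (ha : -1 < a) (hb : -1 < b) (n : ℕ) (p q : ℝ) :
    MemLp (jacobiG n p q) 2 (jacobiMeasure a b) := by
  have : jacobiG n p q = fun x => (jacobiPoly n p q).eval x := by
    ext x; exact (eval_jacobiPoly n p q x).symm
  rw [this]
  exact memLp_eval ha hb _

theorem jacobiG_zero (a b : ℝ) : jacobiG 0 a b = fun _ => 1 := by
  ext x; simp [jacobiG, jacobiP]

end Data

end FracDiff

end

/-! ### The main theorem: the choice of A and the flux. -/

theorem mainTheorem1 (α r β : ℝ) (hα₁ : 1 < α) (hα₂ : α < 2) (hr₀ : 0 ≤ r) (hr₁ : r ≤ 1)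
    (hβ₀ : α - 1 ≤ β) (hβ₁ : β ≤ 1)
    (hβ : r = Real.sin (Real.pi * β) /
      (Real.sin (Real.pi * (α - β)) + Real.sin (Real.pi * β)))
    (K : ℝ → ℝ) (Km KM : ℝ) (hKm : 0 < Km)
    (hKmeas : AEMeasurable K (volume.restrict (Ioo (0 : ℝ) 1)))
    (hK : ∀ x ∈ Ioo (0 : ℝ) 1, Km ≤ K x ∧ K x ≤ KM)
    (f : ℝ → ℝ) (hf : MemLp f 2 (FracDiff.jacobiMeasure β (α - β)))
    (hf_one : r = 1 → IntegrableOn f (Ioo (0 : ℝ) 1)) :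
    (∀ x ∈ Ioo (0 : ℝ) 1, IntervalIntegrable f volume 0 x) ∧
    MemLp (FracDiff.f₁ K f) 2 (FracDiff.jacobiMeasure (β - 1) (α - β - 1)) ∧
    MemLp (FracDiff.f₂ K) 2 (FracDiff.jacobiMeasure (β - 1) (α - β - 1)) ∧
    0 < FracDiff.wInner (β - 1) (α - β - 1) (fun x => (K x)⁻¹) (fun _ => 1) ∧
    ∃ u : ℝ → ℝ,
      MemLp u 2 (FracDiff.jacobiMeasure (-(α - β)) (-β)) ∧
      FracDiff.IsSolution α r β K f u (FracDiff.constA α β K f) ∧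
      Tendsto (fun N => eLpNorm (fun x => FracDiff.partialSol α β K f N x - u x) 2
        (FracDiff.jacobiMeasure (-(α - β)) (-β))) atTop (𝓝 0) := by
  have h : FracDiff.Admissible (α - β) β :=
    ⟨by linarith, by linarith, by linarith, hβ₁, by linarith, by linarith⟩
  have hr : r = FracDiff.skewness (α - β) β := hβ
  have ha' : -1 < α - β - 1 := by linarith [h.pos_left]
  have hb' : -1 < β - 1 := by linarith [h.pos_right]
  -- If α - β = 1 then sin(π(α-β)) = 0 and r = 1, the case in which f is assumed integrable.
  have halt : α - β < 1 ∨ IntegrableOn f (Ioo (0 : ℝ) 1) := by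
    rcases h.left_le.lt_or_eq with h1 | h1
    · exact Or.inl h1
    · refine Or.inr (hf_one ?_)
      have h2 := h.sin_add_sin_pos
      rw [h1, mul_one, Real.sin_pi, zero_add] at h2
      rw [hβ, h1, mul_one, Real.sin_pi, zero_add, div_self h2.ne']
  obtain ⟨c, hfc⟩ := FracDiff.exists_primitive_bound h.pos_right hβ₁ hf halt
  have hKlow : ∀ x ∈ Ioo (0 : ℝ) 1, Km ≤ K x := fun x hx => (hK x hx).1
  have hf₁ := FracDiff.memLp_f₁ h.pos_left h.pos_right hKm hKmeas hKlow hfc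
  have hf₂ := FracDiff.memLp_f₂ hb' ha' hKm hKmeas hKlow
  have hpos := FracDiff.wInner_inv_pos hb' ha' hKm hKmeas hK
  set A := FracDiff.constA α β K f with hA
  have hg : MemLp (fun x => FracDiff.f₁ K f x - A * FracDiff.f₂ K x) 2
      (FracDiff.jacobiMeasure (β - 1) (α - β - 1)) := hf₁.sub (hf₂.const_mul A)
  have hcoeff : ∀ j, FracDiff.jacobiCoeff α β (fun x => FracDiff.f₁ K f x - A * FracDiff.f₂ K x) j =
      FracDiff.jacobiCoeff α β (FracDiff.f₁ K f) j - A * FracDiff.jacobiCoeff α β (FracDiff.f₂ K) j := by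
    intro j
    unfold FracDiff.jacobiCoeff
    rw [FracDiff.wInner_sub_const_mul hf₁ hf₂ (FracDiff.memLp_jacobiG hb' ha' j _ _), sub_div,
      mul_div_assoc]
  -- Since G_0 = 1, this is the solvability condition (f₁ - A f₂, 1)_ω = 0, which determines A.
  have hg₀ : FracDiff.jacobiCoeff α β (fun x => FracDiff.f₁ K f x - A * FracDiff.f₂ K x) 0 = 0 := by
    have e : FracDiff.f₂ K = fun x => (K x)⁻¹ := by ext x; simp [FracDiff.f₂]
    unfold FracDiff.jacobiCoeff
    rw [FracDiff.wInner_sub_const_mul hf₁ hf₂ (FracDiff.memLp_jacobiG hb' ha' 0 _ _),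
      FracDiff.jacobiG_zero, e, hA, FracDiff.constA, div_mul_cancel₀ _ hpos.ne', sub_self, zero_div]
  obtain ⟨u, hu, hlim⟩ := h.exists_solution hg hg₀
  rw [← hr] at hu
  refine ⟨fun x hx => (hfc x hx).1, hf₁, hf₂, hpos, u, hu.memLp, ⟨hu, ?_⟩, ?_⟩
  -- This flux is continuous on [0,1) with value A at 0, and -q/K is the right-hand side already
  -- solved for.
  · refine ⟨fun x => A - ∫ y in (0 : ℝ)..x, f y, continuousOn_const.sub
      (FracDiff.continuousOn_primitive_Ico fun x hx => (hfc x hx).1), by simp, ?_⟩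
    have e : (fun x => -((A - ∫ y in (0 : ℝ)..x, f y) / K x)) =
        fun x => FracDiff.f₁ K f x - A * FracDiff.f₂ K x := by
      ext x
      simp only [FracDiff.f₁, FracDiff.f₂]
      ring
    rw [e]
    exact hu
  · refine hlim.congr fun N => ?_
    congr 1; ext x
    simp only [hcoeff, FracDiff.partialSol, FracDiff.solCoeff, ← hA, neg_sub]
    simp only [neg_add_eq_sub]
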